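/- Let $K$ be a finite field with $q=|K|\ge 43$, and let $Q^+(5,q)$ be the hyperbolic quadric with equation $x_0x_1+x_2x_3+x_4x_5=0$ in the projective space $\mathrm{PG}(5,q)$ over $K$. The points, lines and planes of $Q^+(5,q)$ are the points, lines and planes of $\mathrm{PG}(5,q)$ all of whose points lie on the quadric; two points of $Q^+(5,q)$ are collinear if some line of $Q^+(5,q)$ contains both. The planes of $Q^+(5,q)$ fall into two families, two planes being in the same family if and only if they are equal or meet in exactly one point; the planes in the family of the plane $x_1=x_3=x_5=0$ are called Greek, the others Latin. A chamber of $Q^+(5,q)$ is a triple $(P,\pi,\tau)$ consisting of a point $P$, a Greek plane $\pi$ and a Latin plane $\tau$ of $Q^+(5,q)$ with $P\in\pi$ and $P\in\tau$. Two chambers $(P_1,\pi_1,\tau_1)$ and $(P_2,\pi_2,\tau_2)$ are opposite if $P_1$ and $P_2$ are not collinear and $\pi_1\cap\tau_2=\pi_2\cap\tau_1=\emptyset$. Let $X$ be a set of mutually non-opposite chambers of $Q^+(5,q)$. Then $|X|\le (q^2+q+1)(q+1)^2$. Moreover, $|X|=(q^2+q+1)(q+1)^2$ if and only if there is a plane $E$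 of $Q^+(5,q)$ such that $X$ is the set of all chambers $(P,\pi,\tau)$ of $Q^+(5,q)$ with $P\in E$. -/

import Mathlib

/-- The hyperbolic quadratic form `x₀x₁ + x₂x₃ + x₄x₅` on `K⁶`. -/
def hypForm (K : Type*) [Field K] : QuadraticForm K (Fin 6 → K) :=
  QuadraticMap.linMulLin (LinearMap.proj 0) (LinearMap.proj 1) +
  QuadraticMap.linMulLin (LinearMap.proj 2) (LinearMap.proj 3) +
  QuadraticMap.linMulLin (LinearMap.proj 4) (LinearMap.proj 5)

theorem hypForm_apply {K : Type*} [Field K] (x : Fin 6 → K) :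
    hypForm K x = x 0 * x 1 + x 2 * x 3 + x 4 * x 5 := rfl

namespace KleinQuadric

variable {K : Type*} [Field K]

/-- The projective subspace given by the linear subspace `W` lies on the quadric. -/
def OnQuadric (W : Submodule K (Fin 6 → K)) : Prop := ∀ x ∈ W, hypForm K x = 0

/-- Points of the quadric (vector dimension 1). -/
def IsPoint (W : Submodule K (Fin 6 → K)) : Prop := Module.finrank K W = 1 ∧ OnQuadric W

/-- Lines of the quadric (vector dimension 2). -/
def IsLine (W : Submodule K (Fin 6 → K)) : Prop := Module.finrank K W = 2 ∧ OnQuadric W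

/-- Planes of the quadric (vector dimension 3). -/
def IsPlane (W : Submodule K (Fin 6 → K)) : Prop := Module.finrank K W = 3 ∧ OnQuadric W

/-- Two points of the quadric are collinear if some line of the quadric contains both. -/
def Collinear (P P' : Submodule K (Fin 6 → K)) : Prop := ∃ L, IsLine L ∧ P ≤ L ∧ P' ≤ L

/-- The plane `x₁ = x₃ = x₅ = 0`, which names the two families of planes. -/
def basePlane (K : Type*) [Field K] : Submodule K (Fin 6 → K) where
  carrier := {x | x 1 = 0 ∧ x 3 = 0 ∧ x 5 = 0}
  add_mem' := by
    rintro a b ⟨h1, h2, h3⟩ ⟨h4, h5, h6⟩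
    simp [h1, h2, h3, h4, h5, h6]
  zero_mem' := by simp
  smul_mem' := by
    rintro c a ⟨h1, h2, h3⟩
    simp [h1, h2, h3]

/-- Two planes of the quadric belong to the same family when they are equal or meet in exactly
one point, i.e. when their intersection has odd vector dimension. The Greek planes are those in
the family of `basePlane K`. -/
def IsGreek (W : Submodule K (Fin 6 → K)) : Prop :=
  IsPlane W ∧ Odd (Module.finrank K ↥(W ⊓ basePlane K))

/-- The Latin planes are the planes of the other family: those that are disjoint from
`basePlane K` or meet it in a line. -/
def IsLatin (W : Submodule K (Fin 6 → K)) : Prop :=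
  IsPlane W ∧ Even (Module.finrank K ↥(W ⊓ basePlane K))

/-- Chambers: a point of the quadric on a Greek plane and on a Latin plane. -/
@[ext]
structure Chamber (K : Type*) [Field K] where
  point : Submodule K (Fin 6 → K)
  greek : Submodule K (Fin 6 → K)
  latin : Submodule K (Fin 6 → K)
  isPoint : IsPoint point
  isGreek : IsGreek greek
  isLatin : IsLatin latin
  point_le_greek : point ≤ greek
  point_le_latin : point ≤ latin

/-- Opposite chambers. Disjointness of projective subspaces is triviality of the intersection of
the linear subspaces. -/
def Opposite (c d : Chamber K) : Prop :=
  ¬ Collinear c.point d.point ∧ c.greek ⊓ d.latin = ⊥ ∧ d.greek ⊓ c.latin = ⊥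

end KleinQuadric

/-!
By the Klein correspondence (`kleinSpace`) the Greek planes, the points and the Latin planes of
`Q⁺(5,q)` are the points, the lines and the planes of a projective space of dimension three and
order `q`; chambers become flags, and two chambers are opposite when the lines of the two flags are
disjoint and neither point is on the plane of the other flag. The proof takes place in that
space, for which only the incidence laws collected in `ProjectiveSpace3` are used. They hold on the
quadric because every line of it is on exactly two planes (`exists_second_plane`) and because the
dimensions in which three planes meet pairwise have an odd sum (`odd_finrank_inf`).

The bound is the Hoffman bound for the opposition graph `A` on flags: its degree is `q⁶` and its
least eigenvalue is `-q⁴`, so that a coclique contains at most `1 / (1 + q²)` of all flags. Let `f`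
be a function on flags. For a fixed line it is a matrix indexed by the `q + 1` points and the
`q + 1` planes of the line, and it is split into its mean, the deviations of its row sums and of its
column sums, and a core with vanishing row and column sums. The form of `A` respects this
decomposition (`oppForm_eq`), and the parts are bounded separately:
* on the means, `A` is `q²` times the graph of disjoint lines, whose least eigenvalue is `-q²`
  (`sum_mul_iDisj_ge`);
* between row and column deviations it is `-q` times the cross form, of norm `q³`
  (`crossForm_le`); this form is diagonalized by separating the deviations that come from a function
  on points, or on planes;
* on the cores it is a graph of degree `q⁴`, so that adding `q⁴` gives a sum of squares
  (`sum_link_eq`), which is definite since every flag lies in a triangle (`eq_zero_of_sum_link`).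

If `f` is the indicator of a set `X` attaining the bound, all these inequalities are equalities, and
`f = g(x) + g'(H) + b(l)` on flags `(x, l, H)`, where `q g'(H)` is the sum of `g` over `H` and `g`
has sum zero (`exists_of_oppForm_le`). As `f` has values `0` and `1`, both `g` and `g'` take at most
two values, which differ by one, and on every line one of them is constant. A counting
argument then shows that `g'` is constant (`forall_or_forall_not`), so `g` and `g'` vanish
(`eq_zero_of_zero_one`). Hence `X` consists of all flags on `q² + q + 1` pairwise intersecting lines,
which are the lines on a point or the lines in a plane (`star_or_ruled_of_meet`). On the quadric
these are the points of a Greek or of a Latin plane.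
-/

set_option linter.unusedSectionVars false

noncomputable section

open scoped Classical

/-! ### Projective spaces of dimension three -/

/-- A projective space of dimension three and order `q`, given by its points, lines and planes and
the three incidence relations. The list of laws is closed under exchanging points and planes. -/
structure ProjectiveSpace3 (Pt Ln Pl : Type*) (q : ℕ) where
  /-- incidence of points and lines -/
  pl : Pt → Ln → Prop
  /-- incidence of lines and planes -/
  lh : Ln → Pl → Prop
  /-- incidence of points and planes -/
  ph : Pt → Pl → Prop
  nonempty_line : Nonempty Ln
  card_points : ∀ l, Nat.card {x // pl x l} = q + 1
  card_planes : ∀ l, Nat.card {H // lh l H} = q + 1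
  trans : ∀ {x l H}, pl x l → lh l H → ph x H
  join : ∀ {x y}, x ≠ y → ∃ l, pl x l ∧ pl y l
  join_unique : ∀ {x y l m}, x ≠ y → pl x l → pl y l → pl x m → pl y m → l = m
  meet : ∀ {H G}, H ≠ G → ∃ l, lh l H ∧ lh l G
  meet_unique : ∀ {H G l m}, H ≠ G → lh l H → lh l G → lh m H → lh m G → l = m
  span : ∀ {x l}, ¬ pl x l → ∃ H, lh l H ∧ ph x H
  span_unique : ∀ {x l H G}, ¬ pl x l → lh l H → ph x H → lh l G → ph x G → H = G
  cut : ∀ {l H}, ¬ lh l H → ∃ x, pl x l ∧ ph x H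
  cut_unique : ∀ {l H x y}, ¬ lh l H → pl x l → ph x H → pl y l → ph y H → x = y
  line_in : ∀ {x y l H}, x ≠ y → pl x l → pl y l → ph x H → ph y H → lh l H
  line_on : ∀ {x l H G}, H ≠ G → lh l H → lh l G → ph x H → ph x G → pl x l
  card_pencil : ∀ {x H}, ph x H → Nat.card {l // pl x l ∧ lh l H} = q + 1
  card_star : ∀ x, Nat.card {l // pl x l} = q ^ 2 + q + 1
  card_ruled : ∀ H, Nat.card {l // lh l H} = q ^ 2 + q + 1

namespace ProjectiveSpace3

variable {Pt Ln Pl : Type*} {q : ℕ}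

/-- The dual space: points and planes are exchanged. -/
def dual (S : ProjectiveSpace3 Pt Ln Pl q) : ProjectiveSpace3 Pl Ln Pt q where
  pl H l := S.lh l H
  lh l x := S.pl x l
  ph H x := S.ph x H
  nonempty_line := S.nonempty_line
  card_points := S.card_planes
  card_planes := S.card_points
  trans h1 h2 := S.trans h2 h1
  join := S.meet
  join_unique := S.meet_unique
  meet := S.join
  meet_unique := S.join_unique
  span := S.cut
  span_unique := S.cut_unique
  cut := S.span
  cut_unique := S.span_unique
  line_in := S.line_on
  line_on := S.line_in
  card_pencil := by
    intro x H h
    rw [← S.card_pencil h]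
    exact Nat.card_congr (Equiv.subtypeEquivRight fun l => and_comm)
  card_star := S.card_ruled
  card_ruled := S.card_star

variable (S : ProjectiveSpace3 Pt Ln Pl q)

/-- Two lines are disjoint if no point is on both. -/
def Disj (l m : Ln) : Prop := ∀ x, S.pl x l → ¬ S.pl x m

theorem Disj.symm {l m : Ln} (h : S.Disj l m) : S.Disj m l := fun x h1 h2 => h x h2 h1

theorem exists_point_on (l : Ln) : ∃ x, S.pl x l := by
  have : 0 < Nat.card {x // S.pl x l} := by rw [S.card_points]; omega
  obtain ⟨⟨x, hx⟩⟩ := (Nat.card_pos_iff.1 this).1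
  exact ⟨x, hx⟩

theorem exists_plane_on (l : Ln) : ∃ H, S.lh l H := S.dual.exists_point_on l

/-- A line has a point off any given one. -/
theorem exists_point_on_ne (hq : 1 ≤ q) (l : Ln) (x : Pt) : ∃ y, S.pl y l ∧ y ≠ x := by
  by_contra! h
  have : Subsingleton {y // S.pl y l} := ⟨fun a b => Subtype.ext ((h a a.2).trans (h b b.2).symm)⟩
  have h2 := S.card_points l
  have := Finite.card_le_one_iff_subsingleton.2 this
  omega

theorem exists_plane_on_ne (hq : 1 ≤ q) (l : Ln) (H : Pl) : ∃ G, S.lh l G ∧ G ≠ H :=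
  S.dual.exists_point_on_ne hq l H

theorem exists_point_on_ne_ne (hq : 2 ≤ q) (l : Ln) (x z : Pt) :
    ∃ y, S.pl y l ∧ y ≠ x ∧ y ≠ z := by
  by_contra! h
  have h2 := S.card_points l
  have : Finite {y // S.pl y l} := Nat.finite_of_card_ne_zero (by omega)
  have h3 : ({y | S.pl y l} : Set Pt) ⊆ {x, z} := by
    intro y hy
    by_cases hyx : y = x
    · simp [hyx]
    · simp [h y hy hyx]
  have h4 := Set.ncard_le_ncard h3 (Set.toFinite _)
  have h5 : ({x, z} : Set Pt).ncard ≤ 2 := Set.ncard_insert_le _ _ |>.trans (by simp)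
  have h6 : ({y | S.pl y l} : Set Pt).ncard = q + 1 := by rw [← h2]; rfl
  omega

theorem exists_plane_on_ne_ne (hq : 2 ≤ q) (l : Ln) (H G : Pl) :
    ∃ E, S.lh l E ∧ E ≠ H ∧ E ≠ G :=
  S.dual.exists_point_on_ne_ne hq l H G

/-- Intersecting lines span a plane. -/
theorem exists_plane_of_meet (hq : 1 ≤ q) {l m : Ln} {x : Pt} (hl : S.pl x l) (hm : S.pl x m) :
    ∃ H, S.lh l H ∧ S.lh m H := by
  by_cases hlm : l = m
  · subst hlm
    obtain ⟨H, hH⟩ := S.exists_plane_on l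
    exact ⟨H, hH, hH⟩
  obtain ⟨y, hy, hyx⟩ := S.exists_point_on_ne hq m x
  have hyl : ¬ S.pl y l := fun h => hlm (S.join_unique hyx h hl hy hm)
  obtain ⟨H, hH, hyH⟩ := S.span hyl
  exact ⟨H, hH, S.line_in hyx hy hm hyH (S.trans hl hH)⟩

theorem exists_point_of_coplanar (hq : 1 ≤ q) {l m : Ln} {H : Pl} (hl : S.lh l H)
    (hm : S.lh m H) : ∃ x, S.pl x l ∧ S.pl x m :=
  S.dual.exists_plane_of_meet hq hl hm

theorem disj_dual (hq : 1 ≤ q) (l m : Ln) : S.dual.Disj l m ↔ S.Disj l m := by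
  constructor
  · intro h x hl hm
    obtain ⟨H, h1, h2⟩ := S.exists_plane_of_meet hq hl hm
    exact h H h1 h2
  · intro h H hl hm
    obtain ⟨x, h1, h2⟩ := S.exists_point_of_coplanar hq hl hm
    exact h x h1 h2

/-- The indicator of incidence of points and lines. -/
def iPL (x : Pt) (l : Ln) : ℝ := if S.pl x l then 1 else 0

/-- The indicator of incidence of lines and planes. -/
def iLH (l : Ln) (H : Pl) : ℝ := if S.lh l H then 1 else 0

/-- The indicator of incidence of points and planes. -/
def iPH (x : Pt) (H : Pl) : ℝ := if S.ph x H then 1 else 0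

/-- The indicator of disjointness of lines. -/
def iDisj (l m : Ln) : ℝ := if S.Disj l m then 1 else 0

@[simp] theorem dual_iPL (H : Pl) (l : Ln) : S.dual.iPL H l = S.iLH l H := rfl

@[simp] theorem dual_iLH (x : Pt) (l : Ln) : S.dual.iLH l x = S.iPL x l := rfl

theorem dual_iDisj (hq : 1 ≤ q) (l m : Ln) : S.dual.iDisj l m = S.iDisj l m := by
  simp only [iDisj, S.disj_dual hq]

theorem iDisj_comm (l m : Ln) : S.iDisj l m = S.iDisj m l := by
  have : S.Disj l m ↔ S.Disj m l := ⟨fun h => h.symm, fun h => h.symm⟩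
  simp only [iDisj, this]

theorem iPL_mul_self (x : Pt) (l : Ln) : S.iPL x l * S.iPL x l = S.iPL x l := by
  unfold iPL; split_ifs <;> simp

theorem sum_indicator_eq_card {α : Type*} [Fintype α] (P : α → Prop) [DecidablePred P] :
    ∑ a, (if P a then (1 : ℝ) else 0) = (Nat.card {a // P a} : ℝ) := by
  rw [Finset.sum_boole, Nat.card_eq_fintype_card, Fintype.card_subtype]

/-- A sum of indicators of a predicate satisfied exactly once. -/
theorem sum_indicator_unique {α : Type*} [Fintype α] {P : α → Prop} [DecidablePred P] {a : α}
    (ha : P a)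
    (h : ∀ b, P b → b = a) : ∑ b, (if P b then (1 : ℝ) else 0) = 1 := by
  rw [Finset.sum_eq_single a]
  · simp [ha]
  · intro b _ hb
    exact if_neg fun hP => hb (h b hP)
  · simp

variable [Fintype Pt] [Fintype Ln] [Fintype Pl]

theorem sum_iPL_point (l : Ln) : ∑ x, S.iPL x l = q + 1 := by
  unfold iPL
  rw [sum_indicator_eq_card, S.card_points]; push_cast; ring

theorem sum_iLH_plane (l : Ln) : ∑ H, S.iLH l H = q + 1 := S.dual.sum_iPL_point l

theorem sum_iPL_line (x : Pt) : ∑ l, S.iPL x l = q ^ 2 + q + 1 := by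
  unfold iPL
  rw [sum_indicator_eq_card, S.card_star]; push_cast; ring

theorem sum_iPL_mul_iPL_line (x y : Pt) :
    ∑ l, S.iPL x l * S.iPL y l = 1 + if x = y then (q : ℝ) ^ 2 + q else 0 := by
  split_ifs with h
  · subst h
    simp only [iPL_mul_self, sum_iPL_line]; ring
  · obtain ⟨l, hx, hy⟩ := S.join h
    rw [add_zero, ← sum_indicator_unique (P := fun m => S.pl x m ∧ S.pl y m) ⟨hx, hy⟩
      (fun m hm => S.join_unique h hm.1 hm.2 hx hy)]
    refine Finset.sum_congr rfl fun m _ => ?_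
    unfold iPL
    by_cases h1 : S.pl x m <;> by_cases h2 : S.pl y m <;> simp [h1, h2]

theorem sum_iPL_mul_iPL_point (l m : Ln) :
    ∑ x, S.iPL x l * S.iPL x m = 1 - S.iDisj l m + if l = m then (q : ℝ) else 0 := by
  by_cases h : l = m
  · subst h
    simp only [iPL_mul_self, sum_iPL_point, iDisj]
    obtain ⟨x, hx⟩ := S.exists_point_on l
    rw [if_neg fun hd => hd x hx hx]; simp; ring
  · rw [if_neg h, add_zero]
    by_cases hd : S.Disj l m
    · rw [iDisj, if_pos hd, sub_self]
      refine Finset.sum_eq_zero fun x _ => ?_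
      unfold iPL
      by_cases h1 : S.pl x l
      · simp [hd x h1]
      · simp [h1]
    · rw [iDisj, if_neg hd]
      simp only [Disj] at hd
      push Not at hd
      obtain ⟨x, hx, hy⟩ := hd
      rw [sub_zero, ← sum_indicator_unique (P := fun y => S.pl y l ∧ S.pl y m) ⟨hx, hy⟩
        (fun y hm => by_contra fun hne => h (S.join_unique hne hm.1 hx hm.2 hy))]
      refine Finset.sum_congr rfl fun y _ => ?_
      unfold iPL
      by_cases h1 : S.pl y l <;> by_cases h2 : S.pl y m <;> simp [h1, h2]

theorem sum_iPL_mul_iLH (x : Pt) (H : Pl) :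
    ∑ l, S.iPL x l * S.iLH l H = (q + 1) * S.iPH x H := by
  have h1 : ∀ l, S.iPL x l * S.iLH l H = if S.pl x l ∧ S.lh l H then 1 else 0 := by
    intro l; unfold iPL iLH
    by_cases h1 : S.pl x l <;> by_cases h2 : S.lh l H <;> simp [h1, h2]
  simp only [h1]
  unfold iPH
  split_ifs with h
  · rw [sum_indicator_eq_card, S.card_pencil h]; push_cast; ring
  · rw [mul_zero]
    exact Finset.sum_eq_zero fun l _ => if_neg fun h2 => h (S.trans h2.1 h2.2)

theorem sum_iPH_plane (x : Pt) : ∑ H, S.iPH x H = q ^ 2 + q + 1 := by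
  have h : ∑ H, (q + 1) * S.iPH x H = (q + 1) * (q ^ 2 + q + 1) := by
    simp only [← sum_iPL_mul_iLH]
    rw [Finset.sum_comm]
    simp only [← Finset.mul_sum, sum_iLH_plane, ← Finset.sum_mul, sum_iPL_line]
    ring
  rw [← Finset.mul_sum] at h
  exact mul_left_cancel₀ (by positivity) h

theorem sum_iPH_point (H : Pl) : ∑ x, S.iPH x H = q ^ 2 + q + 1 := S.dual.sum_iPH_plane H

theorem iPH_mul_iPH_of_ne {x y : Pt} {l : Ln} (h : x ≠ y) (hx : S.pl x l) (hy : S.pl y l)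
    (H : Pl) : S.iPH x H * S.iPH y H = S.iLH l H := by
  unfold iPH iLH
  by_cases h1 : S.lh l H
  · simp [h1, S.trans hx h1, S.trans hy h1]
  · by_cases h2 : S.ph x H <;> by_cases h3 : S.ph y H <;> simp [h1, h2, h3]
    exact h1 (S.line_in h hx hy h2 h3)

theorem iPH_mul_self (x : Pt) (H : Pl) : S.iPH x H * S.iPH x H = S.iPH x H := by
  unfold iPH; split_ifs <;> simp

theorem sum_iPH_mul_iPH_plane (x y : Pt) :
    ∑ H, S.iPH x H * S.iPH y H = (q + 1) + if x = y then (q : ℝ) ^ 2 else 0 := by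
  split_ifs with h
  · subst h
    simp only [iPH_mul_self, sum_iPH_plane]; ring
  · obtain ⟨l, hx, hy⟩ := S.join h
    simp only [S.iPH_mul_iPH_of_ne h hx hy, sum_iLH_plane, add_zero]

theorem sum_iPL_mul_iPL_mul_iLH (x y : Pt) (H : Pl) :
    ∑ l, S.iPL x l * S.iPL y l * S.iLH l H =
      S.iPH x H * S.iPH y H * (1 + if x = y then (q : ℝ) else 0) := by
  split_ifs with h
  · subst h
    simp only [iPL_mul_self, sum_iPL_mul_iLH, iPH_mul_self]; ring
  · obtain ⟨l, hx, hy⟩ := S.join h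
    rw [S.iPH_mul_iPH_of_ne h hx hy, Finset.sum_eq_single l]
    · simp [iPL, hx, hy]
    · intro m _ hm
      unfold iPL
      by_cases h1 : S.pl x m
      · have : ¬ S.pl y m := fun h2 => hm (S.join_unique h h1 h2 hx hy)
        simp [this]
      · simp [h1]
    · simp

theorem sum_iLH_mul_iLH_of_meet (hq : 1 ≤ q) {x : Pt} {l m : Ln} (hl : S.pl x l)
    (hm : S.pl x m) : ∑ H, S.iLH l H * S.iLH m H = 1 + if l = m then (q : ℝ) else 0 := by
  have h := S.dual.sum_iPL_mul_iPL_point l m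
  simp only [dual_iPL, S.dual_iDisj hq] at h
  rw [h, iDisj, if_neg fun hd => hd x hl hm, sub_zero]

/-- A point off a line is joined to it by one plane. -/
theorem sum_iLH_mul_iPH {x : Pt} {l : Ln} (h : ¬ S.pl x l) : ∑ H, S.iLH l H * S.iPH x H = 1 := by
  obtain ⟨H, h1, h2⟩ := S.span h
  rw [← sum_indicator_unique (P := fun G => S.lh l G ∧ S.ph x G) ⟨h1, h2⟩
    (fun G hG => S.span_unique h hG.1 hG.2 h1 h2)]
  refine Finset.sum_congr rfl fun G _ => ?_
  unfold iLH iPH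
  by_cases h1 : S.lh l G <;> by_cases h2 : S.ph x G <;> simp [h1, h2]

theorem card_point (S : ProjectiveSpace3 Pt Ln Pl q) : (Fintype.card Pt : ℝ) = q ^ 3 + q ^ 2 + q + 1 := by
  obtain ⟨l⟩ := S.nonempty_line
  obtain ⟨x, -⟩ := S.exists_point_on l
  have h : ∑ y, ∑ l, S.iPL x l * S.iPL y l = Fintype.card Pt + (q ^ 2 + q) := by
    simp only [sum_iPL_mul_iPL_line, Finset.sum_add_distrib]
    simp
  rw [Finset.sum_comm] at h
  simp only [← Finset.mul_sum, sum_iPL_point, ← Finset.sum_mul, sum_iPL_line] at h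
  linarith

theorem card_line (S : ProjectiveSpace3 Pt Ln Pl q) :
    (Fintype.card Ln : ℝ) = (q ^ 2 + 1) * (q ^ 2 + q + 1) := by
  have h : ∑ l, ∑ x, S.iPL x l = Fintype.card Ln * (q + 1) := by
    simp only [sum_iPL_point, Finset.sum_const, Finset.card_univ, nsmul_eq_mul]
  rw [Finset.sum_comm] at h
  simp only [sum_iPL_line, Finset.sum_const, Finset.card_univ, nsmul_eq_mul, S.card_point] at h
  have : (q + 1 : ℝ) ≠ 0 := by positivity
  apply mul_right_cancel₀ this
  rw [← h]; ring

theorem sum_iDisj (l : Ln) : ∑ m, S.iDisj l m = q ^ 4 := by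
  have h : ∑ m, ∑ x, S.iPL x l * S.iPL x m = Fintype.card Ln - ∑ m, S.iDisj l m + q := by
    simp only [sum_iPL_mul_iPL_point, Finset.sum_add_distrib, Finset.sum_sub_distrib]
    simp
  rw [Finset.sum_comm] at h
  simp only [← Finset.mul_sum, sum_iPL_line, ← Finset.sum_mul, sum_iPL_point, S.card_line] at h
  linarith

/-! ### Line sums, plane sums and the graph of disjoint lines -/

/-- The sum over the points of a line. -/
def lineSum (g : Pt → ℝ) (l : Ln) : ℝ := ∑ x, S.iPL x l * g x

/-- The sum over the points of a plane. -/
def planeSum (g : Pt → ℝ) (H : Pl) : ℝ := ∑ x, S.iPH x H * g x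

theorem sum_lineSum_mul (g : Pt → ℝ) (F : Ln → ℝ) :
    ∑ l, S.lineSum g l * F l = ∑ x, g x * ∑ l, S.iPL x l * F l := by
  simp only [lineSum, Finset.sum_mul, Finset.mul_sum]
  rw [Finset.sum_comm]
  exact Finset.sum_congr rfl fun x _ => Finset.sum_congr rfl fun l _ => by ring

theorem sum_iPL_mul_lineSum (g : Pt → ℝ) (x : Pt) :
    ∑ l, S.iPL x l * S.lineSum g l = ∑ y, g y + (q ^ 2 + q) * g x := by
  have h : ∀ y, ∑ l, S.iPL x l * S.iPL y l * g y =
      g y + if x = y then ((q : ℝ) ^ 2 + q) * g y else 0 := by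
    intro y
    rw [← Finset.sum_mul, sum_iPL_mul_iPL_line]
    split_ifs <;> ring
  simp only [lineSum, Finset.mul_sum]
  rw [Finset.sum_comm]
  simp only [← mul_assoc, h, Finset.sum_add_distrib]
  simp

theorem sum_lineSum (g : Pt → ℝ) : ∑ l, S.lineSum g l = (q ^ 2 + q + 1) * ∑ x, g x := by
  have := S.sum_lineSum_mul g (fun _ => 1)
  simp only [mul_one, sum_iPL_line] at this
  rw [this, ← Finset.sum_mul, mul_comm]

theorem sum_planeSum (g : Pt → ℝ) : ∑ H, S.planeSum g H = (q ^ 2 + q + 1) * ∑ x, g x := by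
  simp only [planeSum]
  rw [Finset.sum_comm]
  simp only [← Finset.sum_mul, sum_iPH_plane, Finset.mul_sum]

theorem sum_planeSum_sq (g : Pt → ℝ) :
    ∑ H, S.planeSum g H ^ 2 = (q + 1) * (∑ x, g x) ^ 2 + q ^ 2 * ∑ x, g x ^ 2 := by
  have h : ∀ x y, ∑ H, S.iPH x H * g x * (S.iPH y H * g y) =
      (q + 1) * (g x * g y) + if x = y then (q : ℝ) ^ 2 * (g x * g y) else 0 := by
    intro x y
    have : ∀ H, S.iPH x H * g x * (S.iPH y H * g y) = S.iPH x H * S.iPH y H * (g x * g y) := by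
      intro H; ring
    simp only [this]
    rw [← Finset.sum_mul, sum_iPH_mul_iPH_plane]
    split_ifs <;> ring
  have h2 : ∀ x, ∑ H, ∑ y, S.iPH x H * g x * (S.iPH y H * g y) =
      ∑ y, (q + 1) * (g x * g y) + q ^ 2 * (g x * g x) := by
    intro x
    rw [Finset.sum_comm]
    simp only [h, Finset.sum_add_distrib]
    simp
  have h3 : ∑ H, S.planeSum g H ^ 2 = ∑ H, ∑ x, ∑ y, S.iPH x H * g x * (S.iPH y H * g y) :=
    Finset.sum_congr rfl fun H _ => by rw [planeSum, sq, Finset.sum_mul_sum]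
  rw [h3, Finset.sum_comm]
  simp only [h2]
  rw [Finset.sum_add_distrib]
  simp only [← Finset.mul_sum, ← Finset.sum_mul, sq]

/-- The least eigenvalue of the graph of disjoint lines is `-q ^ 2`. -/
theorem sum_mul_iDisj_ge (hq : 1 ≤ q) (F : Ln → ℝ) :
    q ^ 2 / (q ^ 2 + q + 1) * (∑ l, F l) ^ 2 - q ^ 2 * ∑ l, F l ^ 2 ≤
      ∑ l, ∑ m, F l * F m * S.iDisj l m := by
  have hq0 : (0 : ℝ) < q := by exact_mod_cast hq
  set n := ∑ l, F l with hn
  set g : Pt → ℝ := fun x => ∑ l, S.iPL x l * F l with hg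
  set G := ∑ x, g x ^ 2 with hG
  have hsum : ∑ x, g x = (q + 1) * n := by
    simp only [hg]
    rw [Finset.sum_comm]
    simp only [← Finset.sum_mul, sum_iPL_point, ← Finset.mul_sum, hn]
  have hFg : ∑ l, S.lineSum g l * F l = G := by
    rw [sum_lineSum_mul]
    simp only [hG, hg, sq]
  have hgg : ∑ l, S.lineSum g l * S.lineSum g l = ((q + 1) * n) ^ 2 + (q ^ 2 + q) * G := by
    rw [sum_lineSum_mul]
    have h : ∀ x, g x * (∑ y, g y + (q ^ 2 + q) * g x) =
        g x * ∑ y, g y + (q ^ 2 + q) * g x ^ 2 := fun x => by ring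
    simp only [sum_iPL_mul_lineSum]
    simp only [h]
    rw [Finset.sum_add_distrib, ← Finset.sum_mul, ← Finset.mul_sum, hsum]
    ring
  have hD : ∑ l, ∑ m, F l * F m * S.iDisj l m = n ^ 2 + q * ∑ l, F l ^ 2 - G := by
    have h1 : ∀ l m, F l * F m * S.iDisj l m = F l * F m + (if l = m then q * F l ^ 2 else 0)
        - ∑ x, S.iPL x l * F l * (S.iPL x m * F m) := by
      intro l m
      have h2 := S.sum_iPL_mul_iPL_point l m
      have h3 : ∑ x, S.iPL x l * F l * (S.iPL x m * F m) =
          (∑ x, S.iPL x l * S.iPL x m) * (F l * F m) := by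
        rw [Finset.sum_mul]
        exact Finset.sum_congr rfl fun x _ => by ring
      rw [h3, h2]
      split_ifs with h
      · subst h; ring
      · ring
    have h4 : ∑ l, ∑ m, ∑ x, S.iPL x l * F l * (S.iPL x m * F m) = G := by
      simp only [hG, hg, sq, Finset.sum_mul_sum]
      rw [Finset.sum_comm]
      conv_rhs => rw [Finset.sum_comm]
      rw [Finset.sum_comm]
      exact Finset.sum_congr rfl fun l _ => Finset.sum_comm
    simp only [h1, Finset.sum_add_distrib, Finset.sum_sub_distrib, h4]
    simp only [Finset.sum_ite_eq, Finset.mem_univ, if_true, ← Finset.mul_sum, ← Finset.sum_mul,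
      ← hn, sq]
  -- the square of the distance from `F` to the span of the constants and the line sums of `g`
  set t : ℝ := 1 / (q ^ 2 + q) with ht
  set k : ℝ := n / (q * (q ^ 2 + q + 1)) with hk
  have hsq : 0 ≤ ∑ l, (F l - t * S.lineSum g l + k) ^ 2 :=
    Finset.sum_nonneg fun l _ => sq_nonneg _
  have hexp : ∑ l, (F l - t * S.lineSum g l + k) ^ 2 =
      ∑ l, F l ^ 2 + t ^ 2 * (((q + 1) * n) ^ 2 + (q ^ 2 + q) * G) - 2 * t * G
      + 2 * k * n - 2 * t * k * ((q ^ 2 + q + 1) * ((q + 1) * n))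
      + (q ^ 2 + 1) * (q ^ 2 + q + 1) * k ^ 2 := by
    rw [← hgg, ← hFg, ← hsum, ← S.sum_lineSum, ← S.card_line]
    have h5 : ∀ l, (F l - t * S.lineSum g l + k) ^ 2 = F l ^ 2
      + t ^ 2 * (S.lineSum g l * S.lineSum g l) - 2 * t * (S.lineSum g l * F l) + 2 * k * F l
      - 2 * t * k * S.lineSum g l + k ^ 2 := fun l => by ring
    simp only [h5, Finset.sum_add_distrib, Finset.sum_sub_distrib, ← Finset.mul_sum, ← hn]
    simp
  rw [hexp] at hsq
  have hfin : ∑ l, F l ^ 2 + t ^ 2 * (((q + 1) * n) ^ 2 + (q ^ 2 + q) * G) - 2 * t * G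
      + 2 * k * n - 2 * t * k * ((q ^ 2 + q + 1) * ((q + 1) * n))
      + (q ^ 2 + 1) * (q ^ 2 + q + 1) * k ^ 2 =
      (1 / (q ^ 2 + q)) * (∑ l, F l ^ 2 * (q ^ 2 + q) - G + (q + 1) / (q ^ 2 + q + 1) * n ^ 2) := by
    rw [ht, hk, ← Finset.sum_mul]
    field_simp
    ring
  rw [hfin] at hsq
  have hpos : (0 : ℝ) < 1 / (q ^ 2 + q) := by positivity
  have h6 := nonneg_of_mul_nonneg_right hsq hpos
  rw [← Finset.sum_mul] at h6
  rw [hD]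
  have h7 : (q ^ 2 / (q ^ 2 + q + 1) : ℝ) = 1 - (q + 1) / (q ^ 2 + q + 1) := by field_simp; ring
  rw [h7]
  linarith

/-! ### Functions on point-line flags with vanishing line sums -/

/-- The function on incident point-line pairs obtained from a function on points by subtracting
its mean on every line. -/
def spread (g : Pt → ℝ) (x : Pt) (l : Ln) : ℝ := S.iPL x l * (g x - S.lineSum g l / (q + 1))

theorem spread_of_not {g : Pt → ℝ} {x : Pt} {l : Ln} (h : ¬ S.pl x l) : S.spread g x l = 0 := by
  simp [spread, iPL, h]

theorem sum_spread_point (g : Pt → ℝ) (l : Ln) : ∑ x, S.spread g x l = 0 := by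
  simp only [spread, mul_sub, Finset.sum_sub_distrib, ← Finset.sum_mul, sum_iPL_point]
  rw [← lineSum]
  field_simp
  ring

theorem sum_spread_line {g : Pt → ℝ} (hg : ∑ x, g x = 0) (x : Pt) :
    ∑ l, S.spread g x l = (q ^ 2 + 1) * g x := by
  have h : ∀ l, S.spread g x l = S.iPL x l * g x - (S.iPL x l * S.lineSum g l) / (q + 1) := by
    intro l; rw [spread]; ring
  simp only [h, Finset.sum_sub_distrib, ← Finset.sum_mul, ← Finset.sum_div, sum_iPL_line,
    sum_iPL_mul_lineSum, hg]
  field_simp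
  ring

theorem mul_iPL_of_support {a : Pt → Ln → ℝ} (ha : ∀ x l, ¬ S.pl x l → a x l = 0) (x : Pt)
    (l : Ln) : a x l * S.iPL x l = a x l := by
  by_cases h : S.pl x l
  · simp [iPL, h]
  · simp [ha x l h]

theorem sum_mul_spread {a : Pt → Ln → ℝ} (ha : ∀ x l, ¬ S.pl x l → a x l = 0)
    (ha0 : ∀ l, ∑ x, a x l = 0) (g : Pt → ℝ) :
    ∑ x, ∑ l, a x l * S.spread g x l = ∑ x, g x * ∑ l, a x l := by
  have h : ∀ x l, a x l * S.spread g x l = g x * a x l - a x l * (S.lineSum g l / (q + 1)) := by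
    intro x l
    rw [spread, ← mul_assoc, S.mul_iPL_of_support ha]; ring
  simp only [h, Finset.sum_sub_distrib, ← Finset.mul_sum]
  rw [Finset.sum_comm (f := fun x l => a x l * (S.lineSum g l / (q + 1)))]
  simp only [← Finset.sum_mul, ha0, zero_mul, Finset.sum_const_zero, sub_zero]

theorem sum_spread_sq {g : Pt → ℝ} (hg : ∑ x, g x = 0) :
    ∑ x, ∑ l, S.spread g x l ^ 2 = (q ^ 2 + 1) * ∑ x, g x ^ 2 := by
  have := S.sum_mul_spread (a := S.spread g) (fun x l h => S.spread_of_not h)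
    (S.sum_spread_point g) g
  simp only [S.sum_spread_line hg] at this
  simp only [sq (S.spread _ _ _), this, Finset.mul_sum]
  exact Finset.sum_congr rfl fun x _ => by ring

/-- The form pairing functions on line-plane flags with functions on point-line flags over pairs
of flags `(l, H)`, `(x, m)` with `x` on `l` and `m` in `H`. -/
def pairing (c : Ln → Pl → ℝ) (a : Pt → Ln → ℝ) : ℝ :=
  ∑ l, ∑ H, ∑ m, ∑ x, c l H * a x m * (S.iPL x l * S.iLH m H)

theorem pairing_eq (c : Ln → Pl → ℝ) (a : Pt → Ln → ℝ) :
    S.pairing c a = ∑ x, ∑ H, (∑ l, c l H * S.iPL x l) * (∑ m, a x m * S.iLH m H) := by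
  simp only [pairing, Finset.sum_mul_sum]
  calc _ = ∑ H, ∑ l, ∑ m, ∑ x, c l H * a x m * (S.iPL x l * S.iLH m H) := Finset.sum_comm
    _ = ∑ H, ∑ x, ∑ l, ∑ m, c l H * a x m * (S.iPL x l * S.iLH m H) := by
      refine Finset.sum_congr rfl fun H _ => ?_
      conv_rhs => rw [Finset.sum_comm]
      refine Finset.sum_congr rfl fun l _ => ?_
      rw [Finset.sum_comm]
    _ = _ := by
      rw [Finset.sum_comm]
      exact Finset.sum_congr rfl fun x _ => Finset.sum_congr rfl fun H _ =>
        Finset.sum_congr rfl fun l _ => Finset.sum_congr rfl fun m _ => by ring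

theorem dual_pairing (c : Ln → Pl → ℝ) (a : Pt → Ln → ℝ) :
    S.dual.pairing (fun l x => a x l) (fun H l => c l H) = S.pairing c a := by
  simp only [pairing_eq, dual_iPL, dual_iLH]
  rw [Finset.sum_comm]
  exact Finset.sum_congr rfl fun x _ => Finset.sum_congr rfl fun H _ => mul_comm _ _

theorem pairing_add_right (c : Ln → Pl → ℝ) (a b : Pt → Ln → ℝ) :
    S.pairing c (fun x l => a x l + b x l) = S.pairing c a + S.pairing c b := by
  simp only [pairing, mul_add, add_mul, Finset.sum_add_distrib]

theorem pairing_add_left (c d : Ln → Pl → ℝ) (a : Pt → Ln → ℝ) :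
    S.pairing (fun l H => c l H + d l H) a = S.pairing c a + S.pairing d a := by
  simp only [pairing, add_mul, Finset.sum_add_distrib]

theorem sum_spread_mul_iLH (g : Pt → ℝ) (x : Pt) (H : Pl) :
    ∑ m, S.spread g x m * S.iLH m H =
      S.iPH x H * ((q + 1) * g x - (S.planeSum g H + q * g x) / (q + 1)) := by
  have h1 : ∀ m, S.spread g x m * S.iLH m H = S.iPL x m * S.iLH m H * g x -
      (∑ y, S.iPL x m * S.iPL y m * S.iLH m H * g y) / (q + 1) := by
    intro m
    have : ∑ y, S.iPL x m * S.iPL y m * S.iLH m H * g y =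
        S.iPL x m * S.iLH m H * S.lineSum g m := by
      rw [lineSum, Finset.mul_sum]
      exact Finset.sum_congr rfl fun y _ => by ring
    rw [this, spread]; ring
  have h2 : ∑ m, ∑ y, S.iPL x m * S.iPL y m * S.iLH m H * g y =
      S.iPH x H * (S.planeSum g H + q * g x) := by
    rw [Finset.sum_comm]
    simp only [← Finset.sum_mul, sum_iPL_mul_iPL_mul_iLH]
    have h3 : ∀ y, S.iPH x H * S.iPH y H * (1 + if x = y then (q : ℝ) else 0) * g y =
        S.iPH x H * (S.iPH y H * g y) + if x = y then S.iPH x H * (q * g x) else 0 := by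
      intro y
      split_ifs with h
      · subst h; linear_combination (q * g x) * S.iPH_mul_self x H
      · ring
    simp only [h3, Finset.sum_add_distrib, ← Finset.mul_sum]
    rw [← planeSum]
    simp; ring
  simp only [h1]
  rw [Finset.sum_sub_distrib, ← Finset.sum_div, h2, ← Finset.sum_mul, sum_iPL_mul_iLH]
  ring

theorem pairing_spread {c : Ln → Pl → ℝ} (hc : ∀ l H, ¬ S.lh l H → c l H = 0)
    (hc0 : ∀ l, ∑ H, c l H = 0) (g : Pt → ℝ) :
    S.pairing c (S.spread g) = -∑ H, (∑ l, c l H) * S.planeSum g H := by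
  have hw : ∀ x l H, c l H * S.iPL x l * S.iPH x H = c l H * S.iPL x l := by
    intro x l H
    by_cases h : S.lh l H
    · by_cases h2 : S.pl x l
      · simp [iPH, S.trans h2 h]
      · simp [iPL, h2]
    · simp [hc l H h]
  have h1 : ∀ x H, (∑ l, c l H * S.iPL x l) * (∑ m, S.spread g x m * S.iLH m H) =
      ((q + 1) - q / (q + 1)) * ∑ l, c l H * (S.iPL x l * g x)
        - (1 / (q + 1)) * (∑ l, c l H * S.iPL x l) * S.planeSum g H := by
    intro x H
    have h2 : ∑ l, c l H * (S.iPL x l * g x) = (∑ l, c l H * S.iPL x l) * g x := by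
      rw [Finset.sum_mul]; exact Finset.sum_congr rfl fun l _ => by ring
    have h3 : (∑ l, c l H * S.iPL x l) * S.iPH x H = ∑ l, c l H * S.iPL x l := by
      rw [Finset.sum_mul]; exact Finset.sum_congr rfl fun l _ => hw x l H
    rw [sum_spread_mul_iLH, ← mul_assoc, h3, h2]
    ring
  rw [pairing_eq]
  simp only [h1, Finset.sum_sub_distrib, ← Finset.mul_sum]
  have h4 : ∑ x, ∑ H, ∑ l, c l H * (S.iPL x l * g x) = 0 := by
    refine Finset.sum_eq_zero fun x _ => ?_
    rw [Finset.sum_comm]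
    refine Finset.sum_eq_zero fun l _ => ?_
    rw [← Finset.sum_mul, hc0, zero_mul]
  have h5 : ∑ x, ∑ H, (1 / (q + 1) : ℝ) * (∑ l, c l H * S.iPL x l) * S.planeSum g H =
      ∑ H, (∑ l, c l H) * S.planeSum g H := by
    rw [Finset.sum_comm]
    refine Finset.sum_congr rfl fun H _ => ?_
    rw [← Finset.sum_mul, ← Finset.mul_sum, Finset.sum_comm]
    simp only [← Finset.mul_sum, sum_iPL_point, ← Finset.sum_mul]
    field_simp
  rw [h4, h5]; ring

/-- In the residue of a point: a sum of squares of sums over the pencils of lines. -/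
theorem sum_sum_mul_iLH_sq (hq : 1 ≤ q) {a : Pt → Ln → ℝ}
    (ha : ∀ x l, ¬ S.pl x l → a x l = 0) :
    ∑ x, ∑ H, (∑ m, a x m * S.iLH m H) ^ 2 =
      q * ∑ x, ∑ l, a x l ^ 2 + ∑ x, (∑ l, a x l) ^ 2 := by
  rw [Finset.mul_sum, ← Finset.sum_add_distrib]
  refine Finset.sum_congr rfl fun x _ => ?_
  have h1 : ∀ l m, ∑ H, a x l * S.iLH l H * (a x m * S.iLH m H) =
      a x l * a x m + if l = m then (q : ℝ) * a x l ^ 2 else 0 := by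
    intro l m
    have h2 : ∀ H, a x l * S.iLH l H * (a x m * S.iLH m H) =
        (a x l * a x m) * (S.iLH l H * S.iLH m H) := fun H => by ring
    simp only [h2, ← Finset.mul_sum]
    by_cases hl : S.pl x l
    · by_cases hm : S.pl x m
      · rw [S.sum_iLH_mul_iLH_of_meet hq hl hm]
        split_ifs with h
        · subst h; ring
        · ring
      · have : l ≠ m := fun h => hm (h ▸ hl)
        simp [ha x m hm, this]
    · simp [ha x l hl]
  simp only [sq (∑ l, _), Finset.sum_mul_sum]
  rw [Finset.sum_comm]
  have h3 : ∀ l, ∑ H, ∑ m, a x l * S.iLH l H * (a x m * S.iLH m H) =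
      ∑ m, a x l * a x m + q * a x l ^ 2 := by
    intro l
    rw [Finset.sum_comm]
    simp only [h1, Finset.sum_add_distrib]
    simp
  simp only [h3]
  rw [Finset.sum_add_distrib, Finset.mul_sum, add_comm]

/-! ### The cross form -/

/-- The form pairing functions on line-plane flags with functions on point-line flags over pairs
of flags `(l, H)`, `(x, m)` with disjoint lines `l`, `m` and `x` in `H`. -/
def crossForm (c : Ln → Pl → ℝ) (a : Pt → Ln → ℝ) : ℝ :=
  ∑ l, ∑ H, ∑ m, ∑ x, c l H * a x m * (S.iDisj l m * S.iPH x H)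

/-- If `l` is in `H`, the points of `m` in `H` that belong to `l` are all of them or none, unless
`m` is in `H` as well, in which case the sum over `m` vanishes. -/
theorem sum_mul_iDisj_mul_iPH {a : Pt → Ln → ℝ} (ha : ∀ x l, ¬ S.pl x l → a x l = 0)
    (ha0 : ∀ l, ∑ x, a x l = 0) {l : Ln} {H : Pl} (hl : S.lh l H) (m : Ln) :
    ∑ x, a x m * (S.iDisj l m * S.iPH x H) =
      ∑ x, a x m * S.iPH x H - ∑ x, a x m * S.iPL x l + ∑ x, a x m * (S.iPL x l * S.iLH m H) := by
  by_cases hd : S.Disj l m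
  · have h1 : ∀ x, a x m * S.iPL x l = 0 := by
      intro x
      by_cases h : S.pl x l
      · simp [ha x m (hd x h)]
      · simp [iPL, h]
    simp only [iDisj, if_pos hd, one_mul, ← mul_assoc, h1, zero_mul, Finset.sum_const_zero]
    ring
  · have h0 : S.iDisj l m = 0 := if_neg hd
    simp only [h0, zero_mul, mul_zero, Finset.sum_const_zero]
    by_cases hm : S.lh m H
    · have h1 : ∀ x, a x m * S.iPH x H = a x m := by
        intro x
        by_cases h : S.pl x m
        · simp [iPH, S.trans h hm]
        · simp [ha x m h]
      have h2 : S.iLH m H = 1 := if_pos hm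
      simp only [h1, ha0, h2, mul_one]
      ring
    · have h2 : S.iLH m H = 0 := if_neg hm
      have h1 : ∀ x, a x m * S.iPH x H = a x m * S.iPL x l := by
        intro x
        by_cases h : S.pl x m
        · congr 1
          simp only [Disj] at hd
          push Not at hd
          obtain ⟨z, hzl, hzm⟩ := hd
          have : S.ph x H ↔ S.pl x l := by
            refine ⟨fun hx => ?_, fun hx => S.trans hx hl⟩
            rw [S.cut_unique hm h hx hzm (S.trans hzl hl)]
            exact hzl
          simp only [iPH, iPL, this]
        · simp [ha x m h]
      simp [h1, h2]

theorem crossForm_eq {a : Pt → Ln → ℝ} {c : Ln → Pl → ℝ}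
    (ha : ∀ x l, ¬ S.pl x l → a x l = 0) (ha0 : ∀ l, ∑ x, a x l = 0)
    (hc : ∀ l H, ¬ S.lh l H → c l H = 0) (hc0 : ∀ l, ∑ H, c l H = 0) :
    S.crossForm c a =
      ∑ H, (∑ l, c l H) * S.planeSum (fun x => ∑ m, a x m) H + S.pairing c a := by
  have h1 : ∀ l H m, ∑ x, c l H * a x m * (S.iDisj l m * S.iPH x H) =
      c l H * ∑ x, a x m * S.iPH x H - c l H * ∑ x, a x m * S.iPL x l
        + ∑ x, c l H * a x m * (S.iPL x l * S.iLH m H) := by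
    intro l H m
    by_cases hl : S.lh l H
    · have h2 : ∀ u : Pt → ℝ, ∑ x, c l H * a x m * u x = c l H * ∑ x, a x m * u x := by
        intro u
        rw [Finset.mul_sum]
        exact Finset.sum_congr rfl fun x _ => by ring
      rw [h2, h2, S.sum_mul_iDisj_mul_iPH ha ha0 hl]
      ring
    · simp [hc l H hl]
  simp only [crossForm, pairing, h1, Finset.sum_add_distrib, Finset.sum_sub_distrib]
  have h3 : ∑ l, ∑ H, ∑ m, c l H * ∑ x, a x m * S.iPL x l = 0 := by
    refine Finset.sum_eq_zero fun l _ => ?_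
    rw [Finset.sum_comm]
    refine Finset.sum_eq_zero fun m _ => ?_
    rw [← Finset.sum_mul, hc0, zero_mul]
  have h4 : ∑ l, ∑ H, ∑ m, c l H * ∑ x, a x m * S.iPH x H =
      ∑ H, (∑ l, c l H) * S.planeSum (fun x => ∑ m, a x m) H := by
    rw [Finset.sum_comm]
    refine Finset.sum_congr rfl fun H _ => ?_
    rw [Finset.sum_mul]
    refine Finset.sum_congr rfl fun l _ => ?_
    rw [← Finset.mul_sum, Finset.sum_comm, planeSum]
    simp only [← Finset.sum_mul, mul_comm]
  rw [h3, h4]; ring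

/-- The cross form is bounded by `q ^ 3`; the slack is recorded. -/
theorem crossForm_le (hq : 1 ≤ q) {a a₀ : Pt → Ln → ℝ} {c c₀ : Ln → Pl → ℝ} {g : Pt → ℝ}
    {g' : Pl → ℝ}
    (ha : ∀ x l, ¬ S.pl x l → a x l = 0) (ha0 : ∀ l, ∑ x, a x l = 0)
    (hc : ∀ l H, ¬ S.lh l H → c l H = 0) (hc0 : ∀ l, ∑ H, c l H = 0)
    (hg : ∀ x, ∑ l, a x l = (q ^ 2 + 1) * g x) (hg' : ∀ H, ∑ l, c l H = (q ^ 2 + 1) * g' H)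
    (haa : ∀ x l, a x l = S.spread g x l + a₀ x l)
    (hcc : ∀ l H, c l H = S.dual.spread g' H l + c₀ l H) :
    S.crossForm c a + (q ^ 3 - q) / 2 * (∑ x, ∑ l, a₀ x l ^ 2 + ∑ H, ∑ l, c₀ l H ^ 2)
      + q ^ 3 * (q ^ 2 + 1) / 2 * ∑ H, (g' H - S.planeSum g H / q) ^ 2 ≤
      q ^ 3 / 2 * (∑ x, ∑ l, a x l ^ 2 + ∑ H, ∑ l, c l H ^ 2) := by
  have hq0 : (0 : ℝ) < q := by exact_mod_cast hq
  -- both potentials have sum zero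
  have hgs : ∑ x, g x = 0 := by
    have : ∑ x, (q ^ 2 + 1) * g x = 0 := by
      simp only [← hg]
      rw [Finset.sum_comm]
      simp [ha0]
    rw [← Finset.mul_sum] at this
    exact (mul_eq_zero.1 this).resolve_left (by positivity)
  have hgs' : ∑ H, g' H = 0 := by
    have : ∑ H, (q ^ 2 + 1) * g' H = 0 := by
      simp only [← hg']
      rw [Finset.sum_comm]
      simp [hc0]
    rw [← Finset.mul_sum] at this
    exact (mul_eq_zero.1 this).resolve_left (by positivity)
  -- the remainders
  have ha₀ : ∀ x l, ¬ S.pl x l → a₀ x l = 0 := by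
    intro x l h
    have := haa x l
    rw [ha x l h, S.spread_of_not h] at this
    linarith
  have hc₀ : ∀ H l, ¬ S.lh l H → c₀ l H = 0 := by
    intro H l h
    have := hcc l H
    rw [hc l H h, S.dual.spread_of_not h] at this
    linarith
  have ha₀0 : ∀ l, ∑ x, a₀ x l = 0 := by
    intro l
    have := ha0 l
    simp only [haa, Finset.sum_add_distrib, sum_spread_point] at this
    linarith
  have hc₀0 : ∀ l, ∑ H, c₀ l H = 0 := by
    intro l
    have := hc0 l
    simp only [hcc, Finset.sum_add_distrib, sum_spread_point] at this
    linarith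
  have ha₀1 : ∀ x, ∑ l, a₀ x l = 0 := by
    intro x
    have := hg x
    simp only [haa, Finset.sum_add_distrib, S.sum_spread_line hgs] at this
    linarith
  have hc₀1 : ∀ H, ∑ l, c₀ l H = 0 := by
    intro H
    have := hg' H
    simp only [hcc, Finset.sum_add_distrib, S.dual.sum_spread_line hgs'] at this
    linarith
  -- orthogonality of the decomposition
  have hna : ∑ x, ∑ l, a x l ^ 2 = (q ^ 2 + 1) * ∑ x, g x ^ 2 + ∑ x, ∑ l, a₀ x l ^ 2 := by
    have h0 := S.sum_mul_spread ha₀ ha₀0 g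
    simp only [ha₀1, mul_zero, Finset.sum_const_zero] at h0
    rw [← S.sum_spread_sq hgs]
    have h1 : ∀ x l, a x l ^ 2 =
        S.spread g x l ^ 2 + 2 * (a₀ x l * S.spread g x l) + a₀ x l ^ 2 := by
      intro x l; rw [haa]; ring
    simp only [h1, Finset.sum_add_distrib, ← Finset.mul_sum, h0]
    ring
  have hnc : ∑ H, ∑ l, c l H ^ 2 = (q ^ 2 + 1) * ∑ H, g' H ^ 2 + ∑ H, ∑ l, c₀ l H ^ 2 := by
    have h0 := S.dual.sum_mul_spread (a := fun H l => c₀ l H) hc₀ hc₀0 g'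
    simp only [hc₀1, mul_zero, Finset.sum_const_zero] at h0
    rw [← S.dual.sum_spread_sq hgs']
    have h1 : ∀ H l, c l H ^ 2 =
        S.dual.spread g' H l ^ 2 + 2 * (c₀ l H * S.dual.spread g' H l) + c₀ l H ^ 2 := by
      intro H l; rw [hcc]; ring
    simp only [h1, Finset.sum_add_distrib, ← Finset.mul_sum, h0]
    ring
  -- the pairing
  have hp : S.pairing c a =
      -∑ H, (q ^ 2 + 1) * g' H * S.planeSum g H + S.pairing c₀ a₀ := by
    have e1 : S.pairing c a = S.pairing c (S.spread g) + S.pairing c a₀ := by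
      rw [← pairing_add_right]
      congr 1
      funext x l
      exact haa x l
    have e2 : S.pairing c a₀ = S.pairing (fun l H => S.dual.spread g' H l) a₀ + S.pairing c₀ a₀ := by
      rw [← pairing_add_left]
      congr 1
      funext l H
      exact hcc l H
    have e3 : S.pairing (fun l H => S.dual.spread g' H l) a₀ = 0 := by
      rw [← dual_pairing]
      rw [S.dual.pairing_spread (c := fun l x => a₀ x l) (fun l x h => ha₀ x l h) ha₀0 g']
      simp [ha₀1]
    rw [e1, e2, e3, S.pairing_spread hc hc0]
    simp only [hg']
    ring
  have hp0 : S.pairing c₀ a₀ ≤ q / 2 * (∑ x, ∑ l, a₀ x l ^ 2 + ∑ H, ∑ l, c₀ l H ^ 2) := by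
    have r1 := S.sum_sum_mul_iLH_sq hq ha₀
    have r2 := S.dual.sum_sum_mul_iLH_sq hq (a := fun H l => c₀ l H) hc₀
    simp only [ha₀1] at r1
    simp only [hc₀1, dual_iLH] at r2
    rw [Finset.sum_comm] at r2
    have : S.pairing c₀ a₀ ≤ ∑ x, ∑ H, ((∑ m, a₀ x m * S.iLH m H) ^ 2 / 2 +
        (∑ m, c₀ m H * S.iPL x m) ^ 2 / 2) := by
      rw [pairing_eq]
      refine Finset.sum_le_sum fun x _ => Finset.sum_le_sum fun H _ => ?_
      nlinarith [sq_nonneg (∑ m, a₀ x m * S.iLH m H - ∑ m, c₀ m H * S.iPL x m)]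
    refine this.trans (le_of_eq ?_)
    simp only [Finset.sum_add_distrib, ← Finset.sum_div]
    rw [r1, r2]
    simp
    ring
  -- the part determined by the potentials
  have hy : ∑ H, (∑ l, c l H) * S.planeSum (fun x => ∑ m, a x m) H =
      (q ^ 2 + 1) ^ 2 * ∑ H, g' H * S.planeSum g H := by
    rw [Finset.mul_sum]
    refine Finset.sum_congr rfl fun H _ => ?_
    have : S.planeSum (fun x => ∑ m, a x m) H = (q ^ 2 + 1) * S.planeSum g H := by
      simp only [planeSum, hg, Finset.mul_sum]
      exact Finset.sum_congr rfl fun x _ => by ring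
    rw [this, hg']; ring
  have hs := S.sum_planeSum_sq g
  rw [hgs] at hs
  have hsq : ∑ H, (g' H - S.planeSum g H / q) ^ 2 =
      ∑ H, g' H ^ 2 - 2 / q * ∑ H, g' H * S.planeSum g H + ∑ x, g x ^ 2 := by
    have h1 : ∀ H, (g' H - S.planeSum g H / q) ^ 2 = g' H ^ 2 -
        2 / q * (g' H * S.planeSum g H) + (1 / q ^ 2) * S.planeSum g H ^ 2 := by
      intro H; field_simp; ring
    simp only [h1, Finset.sum_add_distrib, Finset.sum_sub_distrib, ← Finset.mul_sum, hs]
    field_simp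
    ring
  rw [S.crossForm_eq ha ha0 hc hc0, hp, hy, hsq, hna, hnc]
  have h6 : ∑ H, (q ^ 2 + 1) * g' H * S.planeSum g H =
      (q ^ 2 + 1) * ∑ H, g' H * S.planeSum g H := by
    rw [Finset.mul_sum]; exact Finset.sum_congr rfl fun H _ => by ring
  rw [h6]
  have h7 : (q : ℝ) ^ 3 * (q ^ 2 + 1) / 2 * (∑ H, g' H ^ 2
      - 2 / q * ∑ H, g' H * S.planeSum g H + ∑ x, g x ^ 2) =
      q ^ 3 * (q ^ 2 + 1) / 2 * (∑ H, g' H ^ 2 + ∑ x, g x ^ 2)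
      - q ^ 2 * (q ^ 2 + 1) * ∑ H, g' H * S.planeSum g H := by
    field_simp; ring
  rw [h7]
  linarith

/-! ### Opposition between the flags on two disjoint lines -/

/-- A function on point-plane pairs supported on the pairs incident with the line `l`. -/
def SupportedOn (l : Ln) (u : Pt → Pl → ℝ) : Prop :=
  (∀ x H, ¬ S.pl x l → u x H = 0) ∧ ∀ x H, ¬ S.lh l H → u x H = 0

/-- The total of a function on point-plane pairs. -/
def total (u : Pt → Pl → ℝ) : ℝ := ∑ x, ∑ H, u x H

/-- The deviation of the row sums of `u` from their mean. -/
def rowDev (l : Ln) (u : Pt → Pl → ℝ) (x : Pt) : ℝ :=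
  ∑ H, u x H - S.iPL x l * (total u / (q + 1))

/-- The deviation of the column sums of `u` from their mean. -/
def colDev (l : Ln) (u : Pt → Pl → ℝ) (H : Pl) : ℝ :=
  ∑ x, u x H - S.iLH l H * (total u / (q + 1))

/-- The part of `u` all of whose row sums and column sums vanish. -/
def core (l : Ln) (u : Pt → Pl → ℝ) (x : Pt) (H : Pl) : ℝ :=
  u x H - (S.iLH l H * S.rowDev l u x + S.iPL x l * S.colDev l u H) / (q + 1)
    - S.iPL x l * S.iLH l H * (total u / (q + 1) ^ 2)

variable {S} in
theorem SupportedOn.dual {l : Ln} {u : Pt → Pl → ℝ} (h : S.SupportedOn l u) :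
    S.dual.SupportedOn l (fun H x => u x H) :=
  ⟨fun H x => h.2 x H, fun H x => h.1 x H⟩

theorem total_swap (u : Pt → Pl → ℝ) : total (fun H x => u x H) = total u := Finset.sum_comm

theorem dual_rowDev (l : Ln) (u : Pt → Pl → ℝ) :
    S.dual.rowDev l (fun H x => u x H) = S.colDev l u := by
  funext H; simp [rowDev, colDev, total_swap]

theorem dual_core (l : Ln) (u : Pt → Pl → ℝ) (x : Pt) (H : Pl) :
    S.dual.core l (fun H x => u x H) H x = S.core l u x H := by
  have : S.dual.colDev l (fun H x => u x H) x = S.rowDev l u x := by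
    simp [rowDev, colDev, total_swap]
  simp only [core, this, dual_rowDev, total_swap, dual_iPL, dual_iLH]
  ring

variable {S} in
theorem SupportedOn.rowDev_of_not {l : Ln} {u : Pt → Pl → ℝ} (h : S.SupportedOn l u) {x : Pt}
    (hx : ¬ S.pl x l) : S.rowDev l u x = 0 := by
  simp [rowDev, h.1 x _ hx, iPL, hx]

variable {S} in
theorem SupportedOn.colDev_of_not {l : Ln} {u : Pt → Pl → ℝ} (h : S.SupportedOn l u) {H : Pl}
    (hH : ¬ S.lh l H) : S.colDev l u H = 0 := by
  simp [colDev, h.2 _ H hH, iLH, hH]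

variable {S} in
theorem SupportedOn.core {l : Ln} {u : Pt → Pl → ℝ} (h : S.SupportedOn l u) :
    S.SupportedOn l (S.core l u) := by
  constructor
  · intro x H hx
    simp [ProjectiveSpace3.core, h.rowDev_of_not hx, h.1 x H hx, iPL, hx]
  · intro x H hH
    simp [ProjectiveSpace3.core, h.colDev_of_not hH, h.2 x H hH, iLH, hH]

theorem sum_rowDev (l : Ln) (u : Pt → Pl → ℝ) : ∑ x, S.rowDev l u x = 0 := by
  simp only [rowDev, Finset.sum_sub_distrib, ← Finset.sum_mul, sum_iPL_point]
  rw [← total]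
  field_simp
  ring

theorem sum_colDev (l : Ln) (u : Pt → Pl → ℝ) : ∑ H, S.colDev l u H = 0 := by
  rw [← dual_rowDev]
  exact S.dual.sum_rowDev l _

theorem sum_core_plane (l : Ln) (u : Pt → Pl → ℝ) (x : Pt) : ∑ H, S.core l u x H = 0 := by
  simp only [core, Finset.sum_sub_distrib, ← Finset.sum_div, Finset.sum_add_distrib,
    ← Finset.sum_mul, ← Finset.mul_sum, sum_iLH_plane, sum_colDev]
  have : ∑ H, u x H = S.rowDev l u x + S.iPL x l * (total u / (q + 1)) := by rw [rowDev]; ring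
  rw [this]
  field_simp
  ring

theorem sum_core_point (l : Ln) (u : Pt → Pl → ℝ) (H : Pl) : ∑ x, S.core l u x H = 0 := by
  have := S.dual.sum_core_plane l (fun H x => u x H) H
  simpa only [dual_core] using this

/-- The form on pairs of functions supported on two lines `l` and `m`, over the pairs of flags
`(x, l, H)`, `(y, m, G)` with `x` in `G` and `y` in `H`. -/
def link (u v : Pt → Pl → ℝ) : ℝ :=
  ∑ x, ∑ H, ∑ y, ∑ G, u x H * v y G * (S.iPH x G * S.iPH y H)

theorem link_comm (u v : Pt → Pl → ℝ) : S.link u v = S.link v u := by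
  have h : ∀ u v : Pt → Pl → ℝ, S.link u v = ∑ p : Pt × Pl, ∑ r : Pt × Pl,
      u p.1 p.2 * v r.1 r.2 * (S.iPH p.1 r.2 * S.iPH r.1 p.2) := by
    intro u v
    simp only [link, Fintype.sum_prod_type]
  rw [h, h, Finset.sum_comm]
  exact Finset.sum_congr rfl fun p _ => Finset.sum_congr rfl fun r _ => by ring

theorem link_add_left (u u' v : Pt → Pl → ℝ) :
    S.link (fun x H => u x H + u' x H) v = S.link u v + S.link u' v := by
  simp only [link, add_mul, Finset.sum_add_distrib]

theorem not_lh_of_disj (hq : 1 ≤ q) {l m : Ln} (hd : S.Disj l m) {H : Pl} (hl : S.lh l H) :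
    ¬ S.lh m H := fun hm => by
  obtain ⟨x, h1, h2⟩ := S.exists_point_of_coplanar hq hl hm
  exact hd x h1 h2

theorem sum_iPL_mul_iPH (hq : 1 ≤ q) {l m : Ln} (hd : S.Disj l m) {H : Pl} (hl : S.lh l H) :
    ∑ x, S.iPL x m * S.iPH x H = 1 :=
  S.dual.sum_iLH_mul_iPH (S.not_lh_of_disj hq hd hl)

/-- The form `link` against a sum of a function of points and a function of planes. -/
theorem link_sum (hq : 1 ≤ q) {l m : Ln} (hd : S.Disj l m) {v : Pt → Pl → ℝ}
    (hv : S.SupportedOn m v) (A : Pt → ℝ) (B : Pl → ℝ) :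
    S.link (fun x H => S.iLH l H * A x + S.iPL x l * B H) v =
      ∑ x, ∑ G, A x * (∑ y, v y G) * S.iPH x G + ∑ y, ∑ H, (∑ G, v y G) * B H * S.iPH y H := by
  rw [S.link_add_left]
  congr 1
  · refine Finset.sum_congr rfl fun x _ => ?_
    have h1 : ∀ y G, ∑ H, S.iLH l H * A x * v y G * (S.iPH x G * S.iPH y H) =
        A x * v y G * S.iPH x G := by
      intro y G
      by_cases hy : S.pl y m
      · have h2 : ∀ H, S.iLH l H * A x * v y G * (S.iPH x G * S.iPH y H) =
            S.iLH l H * S.iPH y H * (A x * v y G * S.iPH x G) := fun H => by ring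
        simp only [h2, ← Finset.sum_mul]
        rw [S.sum_iLH_mul_iPH fun hyl => hd y hyl hy, one_mul]
      · simp [hv.1 y G hy]
    rw [Finset.sum_comm]
    have h3 : ∀ y, ∑ H, ∑ G, S.iLH l H * A x * v y G * (S.iPH x G * S.iPH y H) =
        ∑ G, A x * v y G * S.iPH x G := by
      intro y
      rw [Finset.sum_comm]
      exact Finset.sum_congr rfl fun G _ => h1 y G
    simp only [h3]
    rw [Finset.sum_comm]
    refine Finset.sum_congr rfl fun G _ => ?_
    rw [Finset.mul_sum, Finset.sum_mul]
  · have h1 : ∀ y G H, ∑ x, S.iPL x l * B H * v y G * (S.iPH x G * S.iPH y H) =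
        v y G * B H * S.iPH y H := by
      intro y G H
      by_cases hG : S.lh m G
      · have h2 : ∀ x, S.iPL x l * B H * v y G * (S.iPH x G * S.iPH y H) =
            S.iPL x l * S.iPH x G * (v y G * B H * S.iPH y H) := fun x => by ring
        simp only [h2, ← Finset.sum_mul]
        rw [S.sum_iPL_mul_iPH hq (hd.symm S) hG, one_mul]
      · simp [hv.2 y G hG]
    rw [link, Finset.sum_comm]
    have h3 : ∀ H, ∑ x, ∑ y, ∑ G, S.iPL x l * B H * v y G * (S.iPH x G * S.iPH y H) =
        ∑ y, (∑ G, v y G) * B H * S.iPH y H := by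
      intro H
      rw [Finset.sum_comm]
      refine Finset.sum_congr rfl fun y _ => ?_
      rw [Finset.sum_comm, Finset.sum_mul, Finset.sum_mul]
      exact Finset.sum_congr rfl fun G _ => h1 y G H
    simp only [h3]
    exact Finset.sum_comm

/-- The form pairing a function of points with a function of planes over incident pairs. -/
def cross (A : Pt → ℝ) (B : Pl → ℝ) : ℝ := ∑ x, ∑ G, A x * B G * S.iPH x G

theorem cross_rowSum_colSum (hq : 1 ≤ q) {l m : Ln} (hd : S.Disj l m) {u v : Pt → Pl → ℝ}
    (hu : S.SupportedOn l u) (hv : S.SupportedOn m v) :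
    S.cross (fun x => ∑ H, u x H) (fun G => ∑ y, v y G) =
      S.cross (S.rowDev l u) (S.colDev m v) + total u * total v / (q + 1) := by
  set α := total u / (q + 1) with hα
  set β := total v / (q + 1) with hβ
  have h1 : ∀ x G, (∑ H, u x H) * (∑ y, v y G) * S.iPH x G =
      S.rowDev l u x * S.colDev m v G * S.iPH x G
      + S.rowDev l u x * β * (S.iLH m G * S.iPH x G)
      + S.colDev m v G * α * (S.iPL x l * S.iPH x G)
      + α * β * S.iPL x l * (S.iLH m G * S.iPH x G) := by
    intro x G
    rw [rowDev, colDev, ← hα, ← hβ]; ring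
  have h2 : ∀ x, ∑ G, S.rowDev l u x * β * (S.iLH m G * S.iPH x G) = S.rowDev l u x * β := by
    intro x
    by_cases hx : S.pl x l
    · rw [← Finset.mul_sum, S.sum_iLH_mul_iPH (hd x hx), mul_one]
    · simp [hu.rowDev_of_not hx]
  have h3 : ∀ G, ∑ x, S.colDev m v G * α * (S.iPL x l * S.iPH x G) = S.colDev m v G * α := by
    intro G
    by_cases hG : S.lh m G
    · rw [← Finset.mul_sum, S.sum_iPL_mul_iPH hq (hd.symm S) hG, mul_one]
    · simp [hv.colDev_of_not hG]
  have h4 : ∀ x, ∑ G, α * β * S.iPL x l * (S.iLH m G * S.iPH x G) = α * β * S.iPL x l := by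
    intro x
    by_cases hx : S.pl x l
    · rw [← Finset.mul_sum, S.sum_iLH_mul_iPH (hd x hx), mul_one]
    · simp [iPL, hx]
  have h5 : ∑ x, ∑ G, S.colDev m v G * α * (S.iPL x l * S.iPH x G) = 0 := by
    rw [Finset.sum_comm]
    simp only [h3, ← Finset.sum_mul, sum_colDev, zero_mul]
  simp only [cross, h1, Finset.sum_add_distrib, h5, h2, h4]
  simp only [← Finset.sum_mul, ← Finset.mul_sum, sum_rowDev, sum_iPL_point]
  rw [hα, hβ]
  field_simp
  ring

/-- The linking form in terms of the core, the deviations and the total. -/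
theorem link_eq (hq : 1 ≤ q) {l m : Ln} (hd : S.Disj l m) {u v : Pt → Pl → ℝ}
    (hu : S.SupportedOn l u) (hv : S.SupportedOn m v) :
    S.link u v = S.link (S.core l u) (S.core m v)
      + (S.cross (S.rowDev l u) (S.colDev m v) + S.cross (S.rowDev m v) (S.colDev l u)) / (q + 1)
      + total u * total v / (q + 1) ^ 2 := by
  have hdec : ∀ (l : Ln) (u : Pt → Pl → ℝ), (fun x H => (fun x H => S.iLH l H *
      (S.rowDev l u x / (q + 1)) + S.iPL x l * ((∑ x, u x H) / (q + 1))) x H + S.core l u x H)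
      = u := by
    intro l u
    funext x H
    have : ∑ x, u x H = S.colDev l u H + S.iLH l H * (total u / (q + 1)) := by rw [colDev]; ring
    simp only [this, core]
    field_simp
    ring
  have h1 : S.link u (S.core m v) = S.link (S.core l u) (S.core m v) := by
    conv_lhs => rw [← hdec l u]
    rw [link_add_left, S.link_sum hq hd hv.core]
    simp [sum_core_plane, sum_core_point]
  have h2 : S.link u v = S.link (fun x H => S.iLH m H * (S.rowDev m v x / (q + 1)) +
      S.iPL x m * ((∑ x, v x H) / (q + 1))) u + S.link u (S.core m v) := by
    rw [S.link_comm u (S.core m v), ← link_add_left, hdec, link_comm]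
  rw [h2, h1, S.link_sum hq (hd.symm S) hu]
  have h3 : ∑ y, ∑ H, (∑ G, u y G) * ((∑ x, v x H) / (q + 1)) * S.iPH y H =
      (S.cross (S.rowDev l u) (S.colDev m v) + total u * total v / (q + 1)) / (q + 1) := by
    rw [← S.cross_rowSum_colSum hq hd hu hv, cross]
    rw [Finset.sum_div]
    refine Finset.sum_congr rfl fun x _ => ?_
    rw [Finset.sum_div]
    exact Finset.sum_congr rfl fun G _ => by ring
  have h4 : ∑ x, ∑ G, S.rowDev m v x / (q + 1) * (∑ y, u y G) * S.iPH x G =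
      S.cross (S.rowDev m v) (S.colDev l u) / (q + 1) := by
    have h5 : ∀ x G, S.rowDev m v x / (q + 1) * (∑ y, u y G) * S.iPH x G =
        S.rowDev m v x * S.colDev l u G * S.iPH x G / (q + 1)
        + S.rowDev m v x * (total u / (q + 1) ^ 2) * (S.iLH l G * S.iPH x G) := by
      intro x G
      have : ∑ y, u y G = S.colDev l u G + S.iLH l G * (total u / (q + 1)) := by rw [colDev]; ring
      rw [this]
      field_simp
    have h6 : ∀ x, ∑ G, S.rowDev m v x * (total u / (q + 1) ^ 2) * (S.iLH l G * S.iPH x G) =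
        S.rowDev m v x * (total u / (q + 1) ^ 2) := by
      intro x
      by_cases hx : S.pl x m
      · rw [← Finset.mul_sum, S.sum_iLH_mul_iPH (hd.symm S x hx), mul_one]
      · simp [hv.rowDev_of_not hx]
    simp only [h5, Finset.sum_add_distrib, h6, ← Finset.sum_mul, sum_rowDev, zero_mul, add_zero,
      cross, Finset.sum_div]
  rw [h3, h4]
  field_simp
  ring

/-- The form of opposition between the flags on two disjoint lines. -/
theorem sum_opposite_eq (hq : 1 ≤ q) {l m : Ln} (hd : S.Disj l m) {u v : Pt → Pl → ℝ}
    (hu : S.SupportedOn l u) (hv : S.SupportedOn m v) :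
    ∑ x, ∑ H, ∑ y, ∑ G, u x H * v y G * ((1 - S.iPH x G) * (1 - S.iPH y H)) =
      (q / (q + 1)) ^ 2 * (total u * total v)
      - q / (q + 1) *
        (S.cross (S.rowDev l u) (S.colDev m v) + S.cross (S.rowDev m v) (S.colDev l u))
      + S.link (S.core l u) (S.core m v) := by
  have h1 : ∀ x H y G, u x H * v y G * ((1 - S.iPH x G) * (1 - S.iPH y H)) =
      u x H * v y G - u x H * v y G * S.iPH x G - u x H * v y G * S.iPH y H
      + u x H * v y G * (S.iPH x G * S.iPH y H) := fun x H y G => by ring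
  have h2 : ∑ x, ∑ H, ∑ y, ∑ G, u x H * v y G = total u * total v := by
    rw [total, Finset.sum_mul]
    refine Finset.sum_congr rfl fun x _ => ?_
    rw [Finset.sum_mul]
    refine Finset.sum_congr rfl fun H _ => ?_
    simp only [total, Finset.mul_sum]
  have h3 : ∀ u v : Pt → Pl → ℝ, ∑ x, ∑ H, ∑ y, ∑ G, u x H * v y G * S.iPH x G =
      S.cross (fun x => ∑ H, u x H) (fun G => ∑ y, v y G) := by
    intro u v
    refine Finset.sum_congr rfl fun x _ => ?_
    have h : ∀ H, ∑ y, ∑ G, u x H * v y G * S.iPH x G = ∑ G, ∑ y, u x H * v y G * S.iPH x G :=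
      fun H => Finset.sum_comm
    simp only [h]
    rw [Finset.sum_comm]
    refine Finset.sum_congr rfl fun G _ => ?_
    rw [Finset.sum_mul_sum, Finset.sum_mul]
    refine Finset.sum_congr rfl fun H _ => ?_
    rw [Finset.sum_mul]
  have h4 : ∑ x, ∑ H, ∑ y, ∑ G, u x H * v y G * S.iPH y H =
      S.cross (fun x => ∑ H, v x H) (fun G => ∑ y, u y G) := by
    rw [← h3]
    have h : ∀ k : Pt → Pl → Pt → Pl → ℝ, ∑ x, ∑ H, ∑ y, ∑ G, k x H y G =
        ∑ p : Pt × Pl, ∑ r : Pt × Pl, k p.1 p.2 r.1 r.2 := by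
      intro k; simp only [Fintype.sum_prod_type]
    rw [h, h, Finset.sum_comm]
    exact Finset.sum_congr rfl fun p _ => Finset.sum_congr rfl fun r _ => by ring
  simp only [h1, Finset.sum_add_distrib, Finset.sum_sub_distrib]
  rw [h2, h3, h4, ← link, S.link_eq hq hd hu hv, S.cross_rowSum_colSum hq hd hu hv,
    S.cross_rowSum_colSum hq (hd.symm S) hv hu]
  field_simp
  ring

theorem sum_sq_eq {l : Ln} {u : Pt → Pl → ℝ} (hu : S.SupportedOn l u) :
    ∑ x, ∑ H, u x H ^ 2 = ∑ x, ∑ H, S.core l u x H ^ 2 +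
      (∑ x, S.rowDev l u x ^ 2 + ∑ H, S.colDev l u H ^ 2) / (q + 1)
      + total u ^ 2 / (q + 1) ^ 2 := by
  have hue : ∀ x H, u x H * S.iLH l H = u x H := by
    intro x H
    by_cases h : S.lh l H
    · simp [iLH, h]
    · simp [hu.2 x H h]
  have hup : ∀ x H, u x H * S.iPL x l = u x H := by
    intro x H
    by_cases h : S.pl x l
    · simp [iPL, h]
    · simp [hu.1 x H h]
  have hx : ∀ x H, u x H ^ 2 = S.core l u x H ^ 2
      + S.core l u x H * (S.iLH l H * (S.rowDev l u x / (q + 1)))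
      + S.core l u x H * (S.iPL x l * ((∑ x, u x H) / (q + 1)))
      + u x H * (S.rowDev l u x / (q + 1)) + u x H * ((∑ x, u x H) / (q + 1)) := by
    intro x H
    have h1 : ∑ x, u x H = S.colDev l u H + S.iLH l H * (total u / (q + 1)) := by rw [colDev]; ring
    have h2 : S.core l u x H = u x H - S.iLH l H * (S.rowDev l u x / (q + 1))
        - S.iPL x l * ((∑ x, u x H) / (q + 1)) := by
      rw [h1, core]; field_simp; ring
    rw [h2]
    linear_combination (S.rowDev l u x / (q + 1)) * hue x H
      + ((∑ x, u x H) / (q + 1)) * hup x H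
  have h3 : ∑ x, ∑ H, S.core l u x H * (S.iLH l H * (S.rowDev l u x / (q + 1))) = 0 := by
    have h : ∀ x H, S.core l u x H * (S.iLH l H * (S.rowDev l u x / (q + 1))) =
        S.core l u x H * (S.rowDev l u x / (q + 1)) := by
      intro x H
      by_cases h : S.lh l H
      · simp [iLH, h]
      · simp [hu.core.2 x H h]
    simp only [h, ← Finset.sum_mul, sum_core_plane, zero_mul, Finset.sum_const_zero]
  have h4 : ∑ x, ∑ H, S.core l u x H * (S.iPL x l * ((∑ x, u x H) / (q + 1))) = 0 := by
    have h : ∀ x H, S.core l u x H * (S.iPL x l * ((∑ x, u x H) / (q + 1))) =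
        S.core l u x H * ((∑ x, u x H) / (q + 1)) := by
      intro x H
      by_cases h : S.pl x l
      · simp [iPL, h]
      · simp [hu.core.1 x H h]
    simp only [h]
    rw [Finset.sum_comm]
    simp only [← Finset.sum_mul, sum_core_point, zero_mul, Finset.sum_const_zero]
  have h5 : ∑ x, ∑ H, u x H * (S.rowDev l u x / (q + 1)) =
      (∑ x, S.rowDev l u x ^ 2) / (q + 1) := by
    have h : ∀ x, ∑ H, u x H * (S.rowDev l u x / (q + 1)) =
        S.rowDev l u x ^ 2 / (q + 1) + S.rowDev l u x * (total u / (q + 1) ^ 2) := by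
      intro x
      rw [← Finset.sum_mul]
      by_cases h : S.pl x l
      · have : ∑ H, u x H = S.rowDev l u x + total u / (q + 1) := by
          rw [rowDev, iPL, if_pos h]; ring
        rw [this]; field_simp
      · simp [hu.rowDev_of_not h]
    simp only [h, Finset.sum_add_distrib, ← Finset.sum_mul, ← Finset.sum_div, sum_rowDev]
    ring
  have h6 : ∑ x, ∑ H, u x H * ((∑ x, u x H) / (q + 1)) =
      (∑ H, S.colDev l u H ^ 2) / (q + 1) + total u ^ 2 / (q + 1) ^ 2 := by
    rw [Finset.sum_comm]
    have h : ∀ H, ∑ x, u x H * ((∑ x, u x H) / (q + 1)) =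
        S.colDev l u H ^ 2 / (q + 1) + S.colDev l u H * (2 * total u / (q + 1) ^ 2)
          + S.iLH l H * (total u ^ 2 / (q + 1) ^ 3) := by
      intro H
      rw [← Finset.sum_mul]
      by_cases h : S.lh l H
      · have : ∑ x, u x H = S.colDev l u H + total u / (q + 1) := by
          rw [colDev, iLH, if_pos h]; ring
        rw [this, iLH, if_pos h]; field_simp; ring
      · have : ∑ x, u x H = 0 := Finset.sum_eq_zero fun x _ => hu.2 x H h
        simp [hu.colDev_of_not h, this, iLH, h]
    simp only [h, Finset.sum_add_distrib, ← Finset.sum_mul, ← Finset.sum_div, sum_colDev,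
      sum_iLH_plane]
    field_simp
    ring
  simp only [hx, Finset.sum_add_distrib]
  rw [h3, h4, h5, h6]
  ring

/-! ### Linked flags and the opposition form -/

theorem exists_line_ne (hq : 1 ≤ q) {x : Pt} {H : Pl} (h : S.ph x H) (l : Ln) :
    ∃ m, S.pl x m ∧ S.lh m H ∧ m ≠ l := by
  by_contra! hc
  have : Subsingleton {m // S.pl x m ∧ S.lh m H} :=
    ⟨fun a b => Subtype.ext ((hc a a.2.1 a.2.2).trans (hc b b.2.1 b.2.2).symm)⟩
  have h2 := S.card_pencil h
  have := Finite.card_le_one_iff_subsingleton.2 this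
  omega

/-- Flags `(x, l, H)` and `(y, m, G)` are linked if their lines are disjoint, `x` is in `G` and `y`
is in `H`. A flag is encoded as the triple of its line, its point and its plane. -/
def Linked (t t' : Ln × Pt × Pl) : Prop :=
  S.Disj t.1 t'.1 ∧ S.ph t.2.1 t'.2.2 ∧ S.ph t'.2.1 t.2.2

/-- The triple consists of mutually incident elements. -/
def IsFlag (t : Ln × Pt × Pl) : Prop := S.pl t.2.1 t.1 ∧ S.lh t.1 t.2.2

theorem linked_of_axis {l k m : Ln} {x y : Pt} {H G : Pl} (hxl : S.pl x l) (hlH : S.lh l H)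
    (hyk : S.pl y k) (hkG : S.lh k G) (hxm : S.pl x m) (hym : S.pl y m) (hmH : S.lh m H)
    (hmG : S.lh m G) (hl : l ≠ m) (hk : k ≠ m) (hxy : x ≠ y) (hHG : H ≠ G) :
    S.Linked (l, x, H) (k, y, G) := by
  refine ⟨fun u hul huk => ?_, S.trans hxm hmG, S.trans hym hmH⟩
  have hum : S.pl u m := S.line_on hHG hmH hmG (S.trans hul hlH) (S.trans huk hkG)
  have h1 : u = x := by_contra fun h => hl (S.join_unique h hul hxl hum hxm)
  have h2 : u = y := by_contra fun h => hk (S.join_unique h huk hyk hum hym)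
  exact hxy (h1.symm.trans h2)

/-- Every flag lies in a triangle of linked flags: they are spread out along a common line. -/
theorem exists_linked_triangle (hq : 2 ≤ q) {t : Ln × Pt × Pl} (ht : S.IsFlag t) :
    ∃ t₁ t₂, S.IsFlag t₁ ∧ S.IsFlag t₂ ∧ S.Linked t t₁ ∧ S.Linked t₁ t₂ ∧ S.Linked t₂ t := by
  obtain ⟨l, x, H⟩ := t
  obtain ⟨hxl, hlH⟩ := ht
  dsimp only at hxl hlH
  obtain ⟨m, hxm, hmH, hml⟩ := S.exists_line_ne (by omega) (S.trans hxl hlH) l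
  obtain ⟨y, hym, hyx⟩ := S.exists_point_on_ne (by omega) m x
  obtain ⟨z, hzm, hzx, hzy⟩ := S.exists_point_on_ne_ne hq m x y
  obtain ⟨G, hmG, hGH⟩ := S.exists_plane_on_ne (by omega) m H
  obtain ⟨E, hmE, hEH, hEG⟩ := S.exists_plane_on_ne_ne hq m H G
  obtain ⟨k, hyk, hkG, hkm⟩ := S.exists_line_ne (by omega) (S.trans hym hmG) m
  obtain ⟨j, hzj, hjE, hjm⟩ := S.exists_line_ne (by omega) (S.trans hzm hmE) m
  exact ⟨(k, y, G), (j, z, E), ⟨hyk, hkG⟩, ⟨hzj, hjE⟩,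
    S.linked_of_axis hxl hlH hyk hkG hxm hym hmH hmG hml.symm hkm hyx.symm hGH.symm,
    S.linked_of_axis hyk hkG hzj hjE hym hzm hmG hmE hkm hjm hzy.symm hEG.symm,
    S.linked_of_axis hzj hjE hxl hlH hzm hxm hmE hmH hjm hml.symm hzx hEH⟩


/-- The indicator of linked flags. -/
def iLinked (t t' : Ln × Pt × Pl) : ℝ :=
  S.iDisj t.1 t'.1 * (S.iPL t.2.1 t.1 * S.iLH t.1 t.2.2) *
    (S.iPL t'.2.1 t'.1 * S.iPH t'.2.1 t.2.2) * (S.iLH t'.1 t'.2.2 * S.iPH t.2.1 t'.2.2)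

theorem iLinked_nonneg (t t' : Ln × Pt × Pl) : 0 ≤ S.iLinked t t' := by
  have h1 : ∀ x l, 0 ≤ S.iPL x l := fun x l => by unfold iPL; split_ifs <;> simp
  have h2 : ∀ x l, 0 ≤ S.iLH x l := fun x l => by unfold iLH; split_ifs <;> simp
  have h3 : ∀ x l, 0 ≤ S.iPH x l := fun x l => by unfold iPH; split_ifs <;> simp
  have h4 : ∀ x l, 0 ≤ S.iDisj x l := fun x l => by unfold iDisj; split_ifs <;> simp
  unfold iLinked
  have := h4 t.1 t'.1
  have := h1 t.2.1 t.1
  have := h1 t'.2.1 t'.1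
  have := h2 t.1 t.2.2
  have := h2 t'.1 t'.2.2
  have := h3 t'.2.1 t.2.2
  have := h3 t.2.1 t'.2.2
  positivity

theorem iLinked_eq_one {t t' : Ln × Pt × Pl} (ht : S.IsFlag t) (ht' : S.IsFlag t')
    (h : S.Linked t t') : S.iLinked t t' = 1 := by
  simp [iLinked, iDisj, iPL, iLH, iPH, ht.1, ht.2, ht'.1, ht'.2, h.1, h.2.1, h.2.2]

theorem iLinked_comm (t t' : Ln × Pt × Pl) : S.iLinked t t' = S.iLinked t' t := by
  rw [iLinked, iLinked, S.iDisj_comm]; ring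

theorem sum_iLinked (hq : 1 ≤ q) (t : Ln × Pt × Pl) :
    ∑ t', S.iLinked t t' = q ^ 4 * (S.iPL t.2.1 t.1 * S.iLH t.1 t.2.2) := by
  obtain ⟨l, x, H⟩ := t
  by_cases hx : S.pl x l
  swap
  · simp [iLinked, iPL, hx]
  by_cases hH : S.lh l H
  swap
  · simp [iLinked, iLH, hH]
  simp only [Fintype.sum_prod_type, iLinked]
  have h1 : S.iPL x l = 1 := if_pos hx
  have h2 : S.iLH l H = 1 := if_pos hH
  simp only [h1, h2, mul_one]
  rw [← S.sum_iDisj l]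
  refine Finset.sum_congr rfl fun m _ => ?_
  by_cases hd : S.Disj l m
  · simp only [mul_assoc, ← Finset.mul_sum]
    rw [S.sum_iLH_mul_iPH (hd x hx)]
    simp only [mul_one]
    rw [S.sum_iPL_mul_iPH hq hd hH, mul_one]
  · simp [iDisj, hd]

/-- Every flag is linked to `q ^ 4` flags, so adding `q ^ 4` times the norm completes the linking
form to a sum of squares. -/
theorem sum_link_eq (hq : 1 ≤ q) {r : Ln → Pt → Pl → ℝ} (hr : ∀ l, S.SupportedOn l (r l)) :
    ∑ l, ∑ m, S.iDisj l m * S.link (r l) (r m) + q ^ 4 * ∑ l, ∑ x, ∑ H, r l x H ^ 2 =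
      (∑ t, ∑ t', S.iLinked t t' * (r t.1 t.2.1 t.2.2 + r t'.1 t'.2.1 t'.2.2) ^ 2) / 2 := by
  set ρ : Ln × Pt × Pl → ℝ := fun t => r t.1 t.2.1 t.2.2 with hρ
  have hs : ∀ t, ρ t * (S.iPL t.2.1 t.1 * S.iLH t.1 t.2.2) = ρ t := by
    rintro ⟨l, x, H⟩
    by_cases hx : S.pl x l
    swap
    · simp [hρ, (hr l).1 x H hx]
    by_cases hH : S.lh l H
    · simp [iPL, iLH, hx, hH]
    · simp [hρ, (hr l).2 x H hH]
  have h1 : ∑ t, ∑ t', S.iLinked t t' * (ρ t * ρ t') =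
      ∑ l, ∑ m, S.iDisj l m * S.link (r l) (r m) := by
    have h2 : ∀ t t', S.iLinked t t' * (ρ t * ρ t') = S.iDisj t.1 t'.1 *
        (ρ t * ρ t' * (S.iPH t.2.1 t'.2.2 * S.iPH t'.2.1 t.2.2)) := by
      intro t t'
      rw [← hs t, ← hs t', iLinked]
      have e1 := S.iPL_mul_self t.2.1 t.1
      have e2 := S.iPL_mul_self t'.2.1 t'.1
      have e3 := S.dual.iPL_mul_self t.2.2 t.1
      have e4 := S.dual.iPL_mul_self t'.2.2 t'.1
      simp only [dual_iPL] at e3 e4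
      calc _ = S.iDisj t.1 t'.1 * ρ t * ρ t' * (S.iPH t.2.1 t'.2.2 * S.iPH t'.2.1 t.2.2) *
            (S.iPL t.2.1 t.1 * S.iPL t.2.1 t.1) * (S.iPL t'.2.1 t'.1 * S.iPL t'.2.1 t'.1) *
            (S.iLH t.1 t.2.2 * S.iLH t.1 t.2.2) * (S.iLH t'.1 t'.2.2 * S.iLH t'.1 t'.2.2) := by
            ring
        _ = _ := by rw [e1, e2, e3, e4]; ring
    simp only [h2]
    simp only [Fintype.sum_prod_type, link, hρ]
    refine Finset.sum_congr rfl fun l _ => ?_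
    simp only [Finset.mul_sum]
    have h3 : ∀ k : Pt → Pl → Ln → Pt → Pl → ℝ, ∑ x, ∑ H, ∑ m, ∑ y, ∑ G, k x H m y G =
        ∑ m, ∑ x, ∑ H, ∑ y, ∑ G, k x H m y G := by
      intro k
      have : ∀ x, ∑ H, ∑ m, ∑ y, ∑ G, k x H m y G = ∑ m, ∑ H, ∑ y, ∑ G, k x H m y G :=
        fun x => Finset.sum_comm
      simp only [this]
      exact Finset.sum_comm
    rw [h3]
  have h4 : ∑ t, ∑ t', S.iLinked t t' * ρ t ^ 2 = q ^ 4 * ∑ l, ∑ x, ∑ H, r l x H ^ 2 := by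
    have h5 : ∀ t, ∑ t', S.iLinked t t' * ρ t ^ 2 = q ^ 4 * ρ t ^ 2 := by
      intro t
      rw [← Finset.sum_mul, S.sum_iLinked hq]
      linear_combination (q ^ 4 * ρ t) * hs t
    simp only [h5]
    rw [← Finset.mul_sum]
    simp only [Fintype.sum_prod_type, hρ]
  have h6 : ∑ t, ∑ t', S.iLinked t t' * ρ t' ^ 2 = q ^ 4 * ∑ l, ∑ x, ∑ H, r l x H ^ 2 := by
    rw [← h4, Finset.sum_comm]
    exact Finset.sum_congr rfl fun t _ => Finset.sum_congr rfl fun t' _ => by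
      rw [S.iLinked_comm]
  have h7 : ∀ t t', S.iLinked t t' * (ρ t + ρ t') ^ 2 = S.iLinked t t' * ρ t ^ 2 +
      2 * (S.iLinked t t' * (ρ t * ρ t')) + S.iLinked t t' * ρ t' ^ 2 := fun t t' => by ring
  change _ = (∑ t, ∑ t', S.iLinked t t' * (ρ t + ρ t') ^ 2) / 2
  simp only [h7, Finset.sum_add_distrib]
  simp only [← Finset.mul_sum]
  rw [h4, h6, h1]
  ring

theorem sum_link_ge (hq : 1 ≤ q) {r : Ln → Pt → Pl → ℝ} (hr : ∀ l, S.SupportedOn l (r l)) :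
    0 ≤ ∑ l, ∑ m, S.iDisj l m * S.link (r l) (r m) + q ^ 4 * ∑ l, ∑ x, ∑ H, r l x H ^ 2 := by
  rw [S.sum_link_eq hq hr]
  refine div_nonneg (Finset.sum_nonneg fun t _ => Finset.sum_nonneg fun t' _ => ?_) (by norm_num)
  exact mul_nonneg (S.iLinked_nonneg t t') (sq_nonneg _)

/-- If the sum of squares vanishes, `r` changes its sign along linked flags, hence is zero on every
triangle of linked flags. -/
theorem eq_zero_of_sum_link (hq : 2 ≤ q) {r : Ln → Pt → Pl → ℝ}
    (hr : ∀ l, S.SupportedOn l (r l))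
    (h : ∑ l, ∑ m, S.iDisj l m * S.link (r l) (r m) + q ^ 4 * ∑ l, ∑ x, ∑ H, r l x H ^ 2 ≤ 0)
    (l : Ln) (x : Pt) (H : Pl) : r l x H = 0 := by
  rw [S.sum_link_eq (by omega) hr] at h
  have hnn : ∀ t t' : Ln × Pt × Pl,
      0 ≤ S.iLinked t t' * (r t.1 t.2.1 t.2.2 + r t'.1 t'.2.1 t'.2.2) ^ 2 :=
    fun t t' => mul_nonneg (S.iLinked_nonneg t t') (sq_nonneg _)
  have h0 : ∑ t, ∑ t', S.iLinked t t' * (r t.1 t.2.1 t.2.2 + r t'.1 t'.2.1 t'.2.2) ^ 2 = 0 :=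
    le_antisymm (by linarith) (Finset.sum_nonneg fun t _ => Finset.sum_nonneg fun t' _ => hnn t t')
  have h1 : ∀ t t', S.IsFlag t → S.IsFlag t' → S.Linked t t' →
      r t.1 t.2.1 t.2.2 + r t'.1 t'.2.1 t'.2.2 = 0 := by
    intro t t' ht ht' htt
    rw [Finset.sum_eq_zero_iff_of_nonneg
      (fun t _ => Finset.sum_nonneg fun t' _ => hnn t t')] at h0
    have h2 := h0 t (Finset.mem_univ _)
    rw [Finset.sum_eq_zero_iff_of_nonneg (fun t' _ => hnn t t')] at h2
    have h3 := h2 t' (Finset.mem_univ _)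
    rw [S.iLinked_eq_one ht ht' htt, one_mul] at h3
    exact pow_eq_zero_iff (by norm_num) |>.1 h3
  by_cases hx : S.pl x l
  swap
  · exact (hr l).1 x H hx
  by_cases hH : S.lh l H
  swap
  · exact (hr l).2 x H hH
  obtain ⟨t₁, t₂, f1, f2, l1, l2, l3⟩ := S.exists_linked_triangle hq (t := (l, x, H)) ⟨hx, hH⟩
  have e1 := h1 _ _ ⟨hx, hH⟩ f1 l1
  have e2 := h1 _ _ f1 f2 l2
  have e3 := h1 _ _ f2 ⟨hx, hH⟩ l3
  dsimp only at e1 e3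
  linarith

/-- The form of the opposition graph of flags. -/
def oppForm (f : Ln → Pt → Pl → ℝ) : ℝ :=
  ∑ l, ∑ m, S.iDisj l m *
    ∑ x, ∑ H, ∑ y, ∑ G, f l x H * f m y G * ((1 - S.iPH x G) * (1 - S.iPH y H))

theorem crossForm_eq_sum_cross (a : Pt → Ln → ℝ) (c : Ln → Pl → ℝ) :
    S.crossForm c a = ∑ l, ∑ m, S.iDisj l m * S.cross (fun x => a x m) (c l) := by
  rw [crossForm]
  refine Finset.sum_congr rfl fun l _ => ?_
  rw [Finset.sum_comm]
  refine Finset.sum_congr rfl fun m _ => ?_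
  rw [cross, Finset.sum_comm, Finset.mul_sum]
  refine Finset.sum_congr rfl fun x _ => ?_
  rw [Finset.mul_sum]
  exact Finset.sum_congr rfl fun H _ => by ring

theorem oppForm_eq (hq : 1 ≤ q) {f : Ln → Pt → Pl → ℝ} (hf : ∀ l, S.SupportedOn l (f l)) :
    S.oppForm f = (q / (q + 1)) ^ 2 * ∑ l, ∑ m, total (f l) * total (f m) * S.iDisj l m
      - 2 * (q / (q + 1)) *
        S.crossForm (fun l => S.colDev l (f l)) (fun x l => S.rowDev l (f l) x)
      + ∑ l, ∑ m, S.iDisj l m * S.link (S.core l (f l)) (S.core m (f m)) := by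
  set X : Ln → Ln → ℝ := fun l m =>
    S.iDisj l m * S.cross (S.rowDev m (f m)) (S.colDev l (f l)) with hX
  have h1 : ∀ l m, S.iDisj l m *
      ∑ x, ∑ H, ∑ y, ∑ G, f l x H * f m y G * ((1 - S.iPH x G) * (1 - S.iPH y H)) =
      (q / (q + 1)) ^ 2 * (total (f l) * total (f m) * S.iDisj l m)
      - (q / (q + 1)) * X m l - (q / (q + 1)) * X l m
      + S.iDisj l m * S.link (S.core l (f l)) (S.core m (f m)) := by
    intro l m
    by_cases hd : S.Disj l m
    · rw [S.sum_opposite_eq hq hd (hf l) (hf m), hX]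
      dsimp only
      rw [S.iDisj_comm m l]
      ring
    · have e1 : S.iDisj l m = 0 := if_neg hd
      have e2 : S.iDisj m l = 0 := by rw [S.iDisj_comm, e1]
      simp [hX, e1, e2]
  have h2 : ∑ l, ∑ m, X m l = ∑ l, ∑ m, X l m := Finset.sum_comm
  rw [oppForm, crossForm_eq_sum_cross]
  simp only [h1, Finset.sum_add_distrib, Finset.sum_sub_distrib, ← Finset.mul_sum]
  rw [h2]
  ring

theorem sum_sq_decomposition {f : Ln → Pt → Pl → ℝ} (hf : ∀ l, S.SupportedOn l (f l)) :
    ∑ l, ∑ x, ∑ H, f l x H ^ 2 = ∑ l, ∑ x, ∑ H, S.core l (f l) x H ^ 2 +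
      (∑ x, ∑ l, S.rowDev l (f l) x ^ 2 + ∑ H, ∑ l, S.colDev l (f l) H ^ 2) / (q + 1) +
      (∑ l, total (f l) ^ 2) / (q + 1) ^ 2 := by
  have : ∀ l, ∑ x, ∑ H, f l x H ^ 2 = _ := fun l => S.sum_sq_eq (hf l)
  simp only [this, Finset.sum_add_distrib, ← Finset.sum_div]
  rw [Finset.sum_comm (f := fun l x => S.rowDev l (f l) x ^ 2),
    Finset.sum_comm (f := fun l H => S.colDev l (f l) H ^ 2)]

/-! ### The Hoffman inequality and the case of equality -/

/-- The function on points whose spread is the projection of the row deviations of `f`. -/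
def potential (f : Ln → Pt → Pl → ℝ) (x : Pt) : ℝ := (∑ l, S.rowDev l (f l) x) / (q ^ 2 + 1)

/-- The function on planes whose spread is the projection of the column deviations of `f`. -/
def copotential (f : Ln → Pt → Pl → ℝ) (H : Pl) : ℝ := (∑ l, S.colDev l (f l) H) / (q ^ 2 + 1)

theorem sum_potential (f : Ln → Pt → Pl → ℝ) : ∑ x, S.potential f x = 0 := by
  simp only [potential, ← Finset.sum_div]
  rw [Finset.sum_comm]
  simp [sum_rowDev]

/-- The Hoffman inequality for the opposition graph, with its slack. -/
theorem oppForm_slack (hq : 1 ≤ q) {f : Ln → Pt → Pl → ℝ} (hf : ∀ l, S.SupportedOn l (f l)) :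
    q ^ 4 / ((q + 1) ^ 2 * (q ^ 2 + q + 1)) * (∑ l, total (f l)) ^ 2
      + 2 * (q / (q + 1)) *
        ((q ^ 3 - q) / 2 * (∑ x, ∑ l, (S.rowDev l (f l) x - S.spread (S.potential f) x l) ^ 2
          + ∑ H, ∑ l, (S.colDev l (f l) H - S.dual.spread (S.copotential f) H l) ^ 2)
        + q ^ 3 * (q ^ 2 + 1) / 2 *
          ∑ H, (S.copotential f H - S.planeSum (S.potential f) H / q) ^ 2)
      + (∑ l, ∑ m, S.iDisj l m * S.link (S.core l (f l)) (S.core m (f m))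
        + q ^ 4 * ∑ l, ∑ x, ∑ H, S.core l (f l) x H ^ 2) ≤
    S.oppForm f + q ^ 4 * ∑ l, ∑ x, ∑ H, f l x H ^ 2 := by
  have hq0 : (0 : ℝ) < q := by exact_mod_cast hq
  have hpos : (q ^ 2 + 1 : ℝ) ≠ 0 := by positivity
  have h1 := S.crossForm_le hq (a := fun x l => S.rowDev l (f l) x)
    (c := fun l => S.colDev l (f l)) (g := S.potential f) (g' := S.copotential f)
    (a₀ := fun x l => S.rowDev l (f l) x - S.spread (S.potential f) x l)
    (c₀ := fun l H => S.colDev l (f l) H - S.dual.spread (S.copotential f) H l)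
    (fun x l h => (hf l).rowDev_of_not h) (fun l => S.sum_rowDev l _)
    (fun l H h => (hf l).colDev_of_not h) (fun l => S.sum_colDev l _)
    (fun x => by rw [potential, mul_div_cancel₀ _ hpos])
    (fun H => by rw [copotential, mul_div_cancel₀ _ hpos])
    (fun x l => by ring) (fun l H => by ring)
  have h2 := S.sum_mul_iDisj_ge hq (fun l => total (f l))
  rw [S.oppForm_eq hq hf, S.sum_sq_decomposition hf]
  set A := ∑ x, ∑ l, S.rowDev l (f l) x ^ 2 + ∑ H, ∑ l, S.colDev l (f l) H ^ 2
  set E := (q ^ 3 - q) / 2 * (∑ x, ∑ l, (S.rowDev l (f l) x - S.spread (S.potential f) x l) ^ 2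
          + ∑ H, ∑ l, (S.colDev l (f l) H - S.dual.spread (S.copotential f) H l) ^ 2)
        + q ^ 3 * (q ^ 2 + 1) / 2 *
          ∑ H, (S.copotential f H - S.planeSum (S.potential f) H / q) ^ 2 with hE
  set M := S.crossForm (fun l => S.colDev l (f l)) (fun x l => S.rowDev l (f l) x)
  set n := ∑ l, total (f l)
  set D := ∑ l, ∑ m, total (f l) * total (f m) * S.iDisj l m
  set N := ∑ l, total (f l) ^ 2
  have h3 : M + E ≤ q ^ 3 / 2 * A := by rw [hE]; linarith
  have h4 : 2 * (q / (q + 1) : ℝ) * (M + E) ≤ 2 * (q / (q + 1)) * (q ^ 3 / 2 * A) :=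
    mul_le_mul_of_nonneg_left h3 (by positivity)
  have h5 : (q / (q + 1) : ℝ) ^ 2 * (q ^ 2 / (q ^ 2 + q + 1) * n ^ 2 - q ^ 2 * N) ≤
      (q / (q + 1)) ^ 2 * D := mul_le_mul_of_nonneg_left h2 (by positivity)
  have h6 : (q / (q + 1) : ℝ) ^ 2 * (q ^ 2 / (q ^ 2 + q + 1) * n ^ 2 - q ^ 2 * N) =
      q ^ 4 / ((q + 1) ^ 2 * (q ^ 2 + q + 1)) * n ^ 2 - q ^ 4 * (N / (q + 1) ^ 2) := by
    field_simp
  have h7 : 2 * (q / (q + 1) : ℝ) * (q ^ 3 / 2 * A) = q ^ 4 * (A / (q + 1)) := by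
    field_simp
  rw [h6] at h5
  rw [h7] at h4
  linarith

theorem oppForm_ge (hq : 1 ≤ q) {f : Ln → Pt → Pl → ℝ} (hf : ∀ l, S.SupportedOn l (f l)) :
    q ^ 4 / ((q + 1) ^ 2 * (q ^ 2 + q + 1)) * (∑ l, total (f l)) ^ 2 ≤
      S.oppForm f + q ^ 4 * ∑ l, ∑ x, ∑ H, f l x H ^ 2 := by
  refine le_trans ?_ (S.oppForm_slack hq hf)
  have h1 := S.sum_link_ge hq (r := fun l => S.core l (f l)) (fun l => (hf l).core)
  have hq1 : (1 : ℝ) ≤ q := by exact_mod_cast hq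
  have h2 : (0 : ℝ) ≤ q ^ 3 - q := by nlinarith [sq_nonneg ((q : ℝ) - 1)]
  have h3 : (0 : ℝ) ≤ 2 * (q / (q + 1)) *
        ((q ^ 3 - q) / 2 * (∑ x, ∑ l, (S.rowDev l (f l) x - S.spread (S.potential f) x l) ^ 2
          + ∑ H, ∑ l, (S.colDev l (f l) H - S.dual.spread (S.copotential f) H l) ^ 2)
        + q ^ 3 * (q ^ 2 + 1) / 2 *
          ∑ H, (S.copotential f H - S.planeSum (S.potential f) H / q) ^ 2) := by
    positivity
  linarith

/-- In the case of equality `f` is, on flags, a sum of functions of the point, of the plane and of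
the line, and the function of the plane is determined by that of the point. -/
theorem exists_of_oppForm_le (hq : 2 ≤ q) {f : Ln → Pt → Pl → ℝ}
    (hf : ∀ l, S.SupportedOn l (f l))
    (h : S.oppForm f + q ^ 4 * ∑ l, ∑ x, ∑ H, f l x H ^ 2 ≤
      q ^ 4 / ((q + 1) ^ 2 * (q ^ 2 + q + 1)) * (∑ l, total (f l)) ^ 2) :
    ∃ (g : Pt → ℝ) (b : Ln → ℝ), ∑ x, g x = 0 ∧
      ∀ l x H, S.pl x l → S.lh l H → f l x H = g x + S.planeSum g H / q + b l := by
  have h0 := S.oppForm_slack (by omega) hf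
  have h1 := S.sum_link_ge (by omega) (r := fun l => S.core l (f l)) (fun l => (hf l).core)
  have hq2 : (2 : ℝ) ≤ q := by exact_mod_cast hq
  have h2 : (0 : ℝ) < q ^ 3 - q := by nlinarith [sq_nonneg ((q : ℝ) - 1)]
  have hq0 : (0 : ℝ) < q := by linarith
  set A := ∑ x, ∑ l, (S.rowDev l (f l) x - S.spread (S.potential f) x l) ^ 2 with hA
  set C := ∑ H, ∑ l, (S.colDev l (f l) H - S.dual.spread (S.copotential f) H l) ^ 2 with hC
  set P := ∑ H, (S.copotential f H - S.planeSum (S.potential f) H / q) ^ 2 with hP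
  have hA0 : 0 ≤ A := Finset.sum_nonneg fun x _ => Finset.sum_nonneg fun l _ => sq_nonneg _
  have hC0 : 0 ≤ C := Finset.sum_nonneg fun x _ => Finset.sum_nonneg fun l _ => sq_nonneg _
  have hP0 : 0 ≤ P := Finset.sum_nonneg fun x _ => sq_nonneg _
  have e1 : 0 ≤ (q ^ 3 - q) / 2 * (A + C) := by positivity
  have e2 : 0 ≤ q ^ 3 * (q ^ 2 + 1) / 2 * P := by positivity
  have e0 : (0 : ℝ) < 2 * (q / (q + 1)) := by positivity
  have e3 : (q ^ 3 - q) / 2 * (A + C) + q ^ 3 * (q ^ 2 + 1) / 2 * P ≤ 0 := by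
    have : 2 * (q / (q + 1)) * ((q ^ 3 - q) / 2 * (A + C) + q ^ 3 * (q ^ 2 + 1) / 2 * P) ≤ 0 := by
      linarith
    by_contra hc
    push Not at hc
    have := mul_pos e0 hc
    linarith
  have hAC : A + C = 0 := by
    have : (q ^ 3 - q) / 2 * (A + C) = 0 := by linarith
    exact (mul_eq_zero.1 this).resolve_left (by positivity)
  have hPz : P = 0 := by
    have : q ^ 3 * (q ^ 2 + 1) / 2 * P = 0 := by linarith
    exact (mul_eq_zero.1 this).resolve_left (by positivity)
  have hAz : A = 0 := by linarith
  have hCz : C = 0 := by linarith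
  have hr := S.eq_zero_of_sum_link hq (r := fun l => S.core l (f l)) (fun l => (hf l).core) (by
    have : 0 ≤ 2 * (q / (q + 1)) *
      ((q ^ 3 - q) / 2 * (A + C) + q ^ 3 * (q ^ 2 + 1) / 2 * P) := by positivity
    linarith)
  have hrow : ∀ x l, S.rowDev l (f l) x = S.spread (S.potential f) x l := by
    intro x l
    rw [hA, Finset.sum_eq_zero_iff_of_nonneg
      (fun x _ => Finset.sum_nonneg fun l _ => sq_nonneg _)] at hAz
    have := hAz x (Finset.mem_univ _)
    rw [Finset.sum_eq_zero_iff_of_nonneg (fun l _ => sq_nonneg _)] at this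
    have := pow_eq_zero_iff (by norm_num) |>.1 (this l (Finset.mem_univ _))
    linarith
  have hcol : ∀ H l, S.colDev l (f l) H = S.dual.spread (S.copotential f) H l := by
    intro x l
    rw [hC, Finset.sum_eq_zero_iff_of_nonneg
      (fun x _ => Finset.sum_nonneg fun l _ => sq_nonneg _)] at hCz
    have := hCz x (Finset.mem_univ _)
    rw [Finset.sum_eq_zero_iff_of_nonneg (fun l _ => sq_nonneg _)] at this
    have := pow_eq_zero_iff (by norm_num) |>.1 (this l (Finset.mem_univ _))
    linarith
  have hcop : ∀ H, S.copotential f H = S.planeSum (S.potential f) H / q := by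
    intro H
    rw [hP, Finset.sum_eq_zero_iff_of_nonneg (fun l _ => sq_nonneg _)] at hPz
    have := pow_eq_zero_iff (by norm_num) |>.1 (hPz H (Finset.mem_univ _))
    linarith
  refine ⟨fun x => S.potential f x / (q + 1), fun l =>
    total (f l) / (q + 1) ^ 2 - S.lineSum (S.potential f) l / (q + 1) ^ 2
      - S.dual.lineSum (S.copotential f) l / (q + 1) ^ 2, ?_, ?_⟩
  · rw [← Finset.sum_div, sum_potential, zero_div]
  · intro l x H hx hH
    have h3 := hr l x H
    rw [core, hrow, hcol, spread, spread, dual_iPL, hcop] at h3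
    have e1 : S.iPL x l = 1 := if_pos hx
    have e2 : S.iLH l H = 1 := if_pos hH
    rw [e1, e2] at h3
    have h4 : S.planeSum (fun x => S.potential f x / (q + 1)) H =
        S.planeSum (S.potential f) H / (q + 1) := by
      simp only [planeSum, Finset.sum_div, mul_div_assoc]
    rw [h4]
    have h5 : f l x H = (1 * (1 * (S.potential f x - S.lineSum (S.potential f) l / (q + 1))) +
      1 * (1 * (S.planeSum (S.potential f) H / q - S.dual.lineSum (S.copotential f) l / (q + 1))))
        / (q + 1) + 1 * 1 * (total (f l) / (q + 1) ^ 2) := by linarith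
    rw [h5]
    field_simp
    ring

/-! ### Sets of mutually non-opposite flags -/

/-- The number of points of `H` that have the property `A`. -/
def count (A : Pt → Prop) (H : Pl) : ℝ := S.planeSum (fun x => if A x then 1 else 0) H

theorem count_not (A : Pt → Prop) (H : Pl) :
    S.count (fun x => ¬ A x) H = q ^ 2 + q + 1 - S.count A H := by
  rw [← S.sum_iPH_point H, count, count, planeSum, planeSum, ← Finset.sum_sub_distrib]
  refine Finset.sum_congr rfl fun x _ => ?_
  by_cases h : A x <;> simp [h]

theorem count_nonneg (A : Pt → Prop) (H : Pl) : 0 ≤ S.count A H := by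
  refine Finset.sum_nonneg fun x _ => mul_nonneg ?_ ?_
  · unfold iPH; split_ifs <;> simp
  · dsimp only; split_ifs <;> simp

theorem count_le (A : Pt → Prop) (H : Pl) : S.count A H ≤ q ^ 2 + q + 1 := by
  have := S.count_nonneg (fun x => ¬ A x) H
  rw [count_not] at this
  linarith

theorem count_eq_iff (A : Pt → Prop) (H : Pl) :
    S.count A H = q ^ 2 + q + 1 ↔ ∀ x, S.ph x H → A x := by
  have h1 : S.count A H = q ^ 2 + q + 1 ↔ S.count (fun x => ¬ A x) H = 0 := by
    rw [count_not, sub_eq_zero, eq_comm]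
  rw [h1, count, planeSum, Finset.sum_eq_zero_iff_of_nonneg]
  · refine forall_congr' fun x => ?_
    by_cases h : S.ph x H <;> by_cases hA : A x <;> simp [iPH, h, hA]
  · intro x _
    refine mul_nonneg ?_ ?_
    · unfold iPH; split_ifs <;> simp
    · split_ifs <;> simp

theorem sum_iPH_mul_count {A : Pt → Prop} {y : Pt} (hy : A y) :
    ∑ E, S.iPH y E * S.count A E = (q + 1) * (Nat.card {z // A z} : ℝ) + q ^ 2 := by
  rw [← sum_indicator_eq_card A]
  simp only [count, planeSum, Finset.mul_sum]
  rw [Finset.sum_comm]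
  have h : ∀ z, ∑ E, S.iPH y E * (S.iPH z E * if A z then 1 else 0) =
      (q + 1) * (if A z then (1 : ℝ) else 0) + if y = z then (q : ℝ) ^ 2 else 0 := by
    intro z
    simp only [← mul_assoc, ← Finset.sum_mul, sum_iPH_mul_iPH_plane]
    by_cases h : y = z
    · subst h; simp [hy]
    · simp [h]
  simp only [h, Finset.sum_add_distrib]
  simp

/-- Let every line be constant with respect to the set `A` of points or the set `T` of planes,
and let the planes of `T` have `q` more points of `A` than the others. Then the planes on a point
of `A` are all in `T` or all outside `T`. -/
theorem false_of_mixed_point (hq : 2 ≤ q) {A : Pt → Prop} {T : Pl → Prop}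
    (hcount : ∀ H G, T H → ¬ T G → S.count A H = S.count A G + q)
    (hline : ∀ l x y H G, S.pl x l → S.pl y l → S.lh l H → S.lh l G →
      A x → ¬ A y → T H → ¬ T G → False)
    {x : Pt} {H G : Pl} (hx : A x) (hxH : S.ph x H) (hxG : S.ph x G) (hH : T H) (hG : ¬ T G) :
    False := by
  have hq0 : (0 : ℝ) < q := by exact_mod_cast (by omega : 0 < q)
  -- a plane on `x` all of whose lines on `x` are mixed with respect to `T` consists of points of `A`
  have hfull : ∀ E, S.ph x E → (∀ l, S.pl x l → S.lh l E → ∃ H G, S.lh l H ∧ S.lh l G ∧ T H ∧ ¬ T G) →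
      S.count A E = q ^ 2 + q + 1 := by
    intro E hxE hE
    rw [count_eq_iff]
    intro y hy
    by_contra hAy
    have hne : x ≠ y := fun h => hAy (h ▸ hx)
    obtain ⟨l, hxl, hyl⟩ := S.join hne
    obtain ⟨H', G', h1, h2, h3, h4⟩ := hE l hxl (S.line_in hne hxl hyl hxE hy)
    exact hline l x y H' G' hxl hyl h1 h2 hx hAy h3 h4
  by_cases hall : ∃ l, S.pl x l ∧ ∀ E, S.lh l E → ¬ T E
  · obtain ⟨l₀, hl₀, hall⟩ := hall
    have hHfull : S.count A H = q ^ 2 + q + 1 := by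
      refine hfull H hxH fun l hxl hlH => ?_
      obtain ⟨E, hE1, hE2⟩ := S.exists_plane_of_meet (by omega) hxl hl₀
      exact ⟨H, E, hlH, hE1, hH, hall E hE2⟩
    have hGc : ∀ E, ¬ T E → S.count A E = q ^ 2 + 1 := by
      intro E hE
      have := hcount H E hH hE
      linarith
    have hTc : ∀ E, T E → ∀ z, S.ph z E → A z := by
      intro E hE
      rw [← count_eq_iff, hcount E G hE hG, hGc G hG]
      ring
    obtain ⟨y, hyG, hAy⟩ : ∃ y, S.ph y G ∧ ¬ A y := by
      by_contra! hc
      have := (S.count_eq_iff A G).2 hc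
      have := hGc G hG
      linarith
    -- count the pairs of a point outside `A` and a plane joining it to `y`
    have h1 : ∑ E, S.iPH y E * S.count (fun z => ¬ A z) E = (q ^ 2 + q + 1) * q := by
      rw [← S.sum_iPH_plane y, Finset.sum_mul]
      refine Finset.sum_congr rfl fun E _ => ?_
      by_cases h : S.ph y E
      · have hE : ¬ T E := fun hE => hAy (hTc E hE y h)
        rw [count_not, hGc E hE]; ring
      · simp [iPH, h]
    have h2 := S.sum_iPH_mul_count (A := fun z => ¬ A z) hAy
    rw [h1] at h2
    have h3 : (q ^ 2 + q + 1) * q = (q + 1) * Nat.card {z // ¬ A z} + q ^ 2 := by exact_mod_cast h2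
    have h4 : q + 1 ∣ 2 := by
      have h5 : ((q : ℤ) ^ 2 + q + 1) * q = (q + 1) * Nat.card {z // ¬ A z} + q ^ 2 := by
        exact_mod_cast h3
      have h6 : ((q + 1 : ℕ) : ℤ) ∣ ((2 : ℕ) : ℤ) :=
        ⟨q ^ 2 - q + 2 - Nat.card {z // ¬ A z}, by push_cast; linear_combination -h5⟩
      exact_mod_cast h6
    have := Nat.le_of_dvd (by norm_num) h4
    omega
  · push Not at hall
    have h1 : S.count A G = q ^ 2 + q + 1 := by
      refine hfull G hxG fun l hxl hlG => ?_
      obtain ⟨E, hE1, hE2⟩ := hall l hxl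
      exact ⟨E, G, hE1, hlG, hE2, hG⟩
    have h2 := hcount H G hH hG
    have h3 := S.count_le A H
    linarith

/-- Under the same conditions the set of planes is trivial, since two planes always share a point
and the conditions are invariant under passing to complements. -/
theorem forall_or_forall_not (hq : 2 ≤ q) {A : Pt → Prop} {T : Pl → Prop}
    (hcount : ∀ H G, T H → ¬ T G → S.count A H = S.count A G + q)
    (hline : ∀ l x y H G, S.pl x l → S.pl y l → S.lh l H → S.lh l G →
      A x → ¬ A y → T H → ¬ T G → False) : (∀ H, T H) ∨ ∀ H, ¬ T H := by
  by_contra! hc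
  obtain ⟨⟨G, hG⟩, ⟨H, hH⟩⟩ := hc
  have hne : H ≠ G := fun h => hG (h ▸ hH)
  obtain ⟨l, hlH, hlG⟩ := S.meet hne
  obtain ⟨x, hx⟩ := S.exists_point_on l
  by_cases hA : A x
  · exact S.false_of_mixed_point hq hcount hline hA (S.trans hx hlH) (S.trans hx hlG) hH hG
  · refine S.false_of_mixed_point hq (A := fun x => ¬ A x) (T := fun H => ¬ T H) ?_ ?_ hA
      (S.trans hx hlG) (S.trans hx hlH) hG (not_not.2 hH)
    · intro H G hH hG
      rw [count_not, count_not, hcount G H (not_not.1 hG) hH]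
      ring
    · intro l x y H G hxl hyl hlH hlG hx hy hH hG
      exact hline l y x G H hyl hxl hlG hlH (not_not.1 hy) hx (not_not.1 hG) hH

/-- A function on flags with values `0` and `1` that is a sum as in `exists_of_oppForm_le`
depends on the line only. -/
theorem eq_zero_of_zero_one (hq : 2 ≤ q) {f : Ln → Pt → Pl → ℝ} {g : Pt → ℝ} {b : Ln → ℝ}
    (hg : ∑ x, g x = 0)
    (hf : ∀ l x H, S.pl x l → S.lh l H → f l x H = g x + S.planeSum g H / q + b l)
    (h01 : ∀ l x H, f l x H = 0 ∨ f l x H = 1) : ∀ x, g x = 0 := by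
  have hq0 : (0 : ℝ) < q := by exact_mod_cast (by omega : 0 < q)
  obtain ⟨l₀⟩ := S.nonempty_line
  obtain ⟨x₁, -⟩ := S.exists_point_on l₀
  obtain ⟨H₁, -⟩ := S.exists_plane_on l₀
  set γ : Pl → ℝ := fun H => S.planeSum g H / q with hγ
  obtain ⟨x₀, -, hx₀⟩ := Finset.exists_max_image Finset.univ g ⟨x₁, Finset.mem_univ _⟩
  obtain ⟨H₀, -, hH₀⟩ := Finset.exists_max_image Finset.univ γ ⟨H₁, Finset.mem_univ _⟩
  -- both functions take at most two values, which differ by one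
  have hg2 : ∀ x, g x ≠ g x₀ → g x = g x₀ - 1 := by
    intro x hx
    have hne : x ≠ x₀ := fun h => hx (h ▸ rfl)
    obtain ⟨l, h1, h2⟩ := S.join hne
    obtain ⟨H, hH⟩ := S.exists_plane_on l
    have e1 := hf l x H h1 hH
    have e2 := hf l x₀ H h2 hH
    have hlt := lt_of_le_of_ne (hx₀ x (Finset.mem_univ _)) hx
    rcases h01 l x H with h | h <;> rcases h01 l x₀ H with h' | h' <;> linarith
  have hγ2 : ∀ H, γ H ≠ γ H₀ → γ H = γ H₀ - 1 := by
    intro H hH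
    have hne : H ≠ H₀ := fun h => hH (h ▸ rfl)
    obtain ⟨l, h1, h2⟩ := S.meet hne
    obtain ⟨x, hx⟩ := S.exists_point_on l
    have e1 := hf l x H hx h1
    have e2 := hf l x H₀ hx h2
    have hlt := lt_of_le_of_ne (hH₀ H (Finset.mem_univ _)) hH
    simp only [hγ] at hlt ⊢
    rcases h01 l x H with h | h <;> rcases h01 l x H₀ with h' | h' <;> linarith
  have hT : (∀ H, γ H = γ H₀) ∨ ∀ H, γ H ≠ γ H₀ := by
    refine S.forall_or_forall_not hq (A := fun x => g x = g x₀) (T := fun H => γ H = γ H₀) ?_ ?_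
    · intro H G hH hG
      have h1 : ∀ E, S.planeSum g E = (g x₀ - 1) * (q ^ 2 + q + 1) +
          S.count (fun x => g x = g x₀) E := by
        intro E
        rw [← S.sum_iPH_point E, count, planeSum, planeSum, Finset.mul_sum,
          ← Finset.sum_add_distrib]
        refine Finset.sum_congr rfl fun x _ => ?_
        by_cases h : g x = g x₀
        · rw [if_pos h, h]; ring
        · rw [if_neg h, hg2 x h]; ring
      have h2 := hγ2 G hG
      have h3 : S.planeSum g G / q = S.planeSum g H / q - 1 := by
        rw [← hH] at h2; exact h2
      rw [h1, h1] at h3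
      field_simp at h3
      linarith
    · intro l x y H G hxl hyl hlH hlG hx hy hH hG
      have e1 := hf l x H hxl hlH
      have e2 := hf l y G hyl hlG
      have e3 := hg2 y hy
      have e4 := hγ2 G hG
      have e5 : S.planeSum g H / q = S.planeSum g H₀ / q := hH
      have e6 : S.planeSum g G / q = S.planeSum g H₀ / q - 1 := e4
      rcases h01 l x H with h | h <;> rcases h01 l y G with h' | h' <;> linarith
  have hconst : ∀ H, γ H = γ H₀ := hT.resolve_right fun h => h H₀ rfl
  have hzero : ∀ H, S.planeSum g H = 0 := by
    have h1 := S.sum_planeSum g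
    have h2 : ∀ H, S.planeSum g H = q * γ H₀ := by
      intro H
      rw [← hconst H, hγ]
      field_simp
    rw [hg, mul_zero] at h1
    simp only [h2, Finset.sum_const, nsmul_eq_mul] at h1 ⊢
    intro _
    refine (mul_eq_zero.1 h1).resolve_left ?_
    exact_mod_cast Finset.card_ne_zero_of_mem (Finset.mem_univ H₁)
  have hsq := S.sum_planeSum_sq g
  simp only [hzero, hg] at hsq
  have h3 : ∑ x, g x ^ 2 = 0 := by
    have : (q : ℝ) ^ 2 * ∑ x, g x ^ 2 = 0 := by simpa using hsq.symm
    exact (mul_eq_zero.1 this).resolve_left (by positivity)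
  intro x
  rw [Finset.sum_eq_zero_iff_of_nonneg (fun x _ => sq_nonneg _)] at h3
  exact pow_eq_zero_iff (by norm_num) |>.1 (h3 x (Finset.mem_univ _))

/-- Pairwise intersecting lines pass through a common point or lie in a common plane. -/
theorem star_or_ruled_of_meet (hq : 1 ≤ q) {L : Ln → Prop}
    (hL : ∀ l m, L l → L m → ¬ S.Disj l m) :
    (∃ x, ∀ l, L l → S.pl x l) ∨ ∃ H, ∀ l, L l → S.lh l H := by
  have hL' : ∀ l m, L l → L m → ∃ x, S.pl x l ∧ S.pl x m := by
    intro l m hl hm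
    have := hL l m hl hm
    simp only [Disj] at this
    push Not at this
    exact this
  by_cases hsub : ∀ l m, L l → L m → l = m
  · by_cases hne : ∃ l, L l
    · obtain ⟨l, hl⟩ := hne
      obtain ⟨x, hx⟩ := S.exists_point_on l
      exact Or.inl ⟨x, fun m hm => hsub l m hl hm ▸ hx⟩
    · push Not at hne
      obtain ⟨l⟩ := S.nonempty_line
      obtain ⟨x, -⟩ := S.exists_point_on l
      exact Or.inl ⟨x, fun m hm => absurd hm (hne m)⟩
  push Not at hsub
  obtain ⟨l₁, l₂, h1, h2, hne⟩ := hsub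
  obtain ⟨x, hx1, hx2⟩ := hL' l₁ l₂ h1 h2
  by_cases hall : ∀ l, L l → S.pl x l
  · exact Or.inl ⟨x, hall⟩
  push Not at hall
  obtain ⟨l₃, h3, hx3⟩ := hall
  obtain ⟨H, hH1, hH2⟩ := S.exists_plane_of_meet hq hx1 hx2
  refine Or.inr ⟨H, ?_⟩
  -- a line that meets `l₁` and `l₂` outside `x` lies in `H`
  have key : ∀ l, L l → ¬ S.pl x l → S.lh l H := by
    intro l hl hxl
    obtain ⟨y, hy, hy1⟩ := hL' l l₁ hl h1
    obtain ⟨z, hz, hz2⟩ := hL' l l₂ hl h2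
    have hyz : y ≠ z := by
      intro h
      subst h
      have : y ≠ x := fun h => hxl (h ▸ hy)
      exact hne (S.join_unique this hy1 hx1 hz2 hx2)
    exact S.line_in hyz hy hz (S.trans hy1 hH1) (S.trans hz2 hH2)
  intro l hl
  by_cases hxl : S.pl x l
  · obtain ⟨y, hy, hy3⟩ := hL' l l₃ hl h3
    have hyx : y ≠ x := fun h => hx3 (h ▸ hy3)
    exact S.line_in hyx hy hxl (S.trans hy3 (key l₃ h3 hx3)) (S.trans hx1 hH1)
  · exact key l hl hxl

/-- The number of flags with line in a given set. -/
theorem card_flags (L : Ln → Prop) :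
    Nat.card {t // S.IsFlag t ∧ L t.1} = (q + 1) ^ 2 * Nat.card {l // L l} := by
  have h : (Nat.card {t // S.IsFlag t ∧ L t.1} : ℝ) = (q + 1) ^ 2 * Nat.card {l // L l} := by
    rw [← sum_indicator_eq_card, ← sum_indicator_eq_card, Fintype.sum_prod_type, Finset.mul_sum]
    refine Finset.sum_congr rfl fun l _ => ?_
    rw [Fintype.sum_prod_type]
    by_cases hl : L l
    · have h1 : ∀ x H, (if S.IsFlag (l, x, H) ∧ L (l, x, H).1 then (1 : ℝ) else 0) =
          S.iPL x l * S.iLH l H := by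
        intro x H
        unfold iPL iLH
        by_cases h1 : S.pl x l <;> by_cases h2 : S.lh l H <;> simp [IsFlag, h1, h2, hl]
      simp only [h1, ← Finset.mul_sum, ← Finset.sum_mul, sum_iPL_point, sum_iLH_plane, if_pos hl]
      ring
    · simp [hl]
  exact_mod_cast h

/-- Opposite flags: the lines are disjoint and neither point is on the plane of the other flag. -/
def Opp (t t' : Ln × Pt × Pl) : Prop :=
  S.Disj t.1 t'.1 ∧ ¬ S.ph t.2.1 t'.2.2 ∧ ¬ S.ph t'.2.1 t.2.2

theorem exists_plane_on_not (hq : 1 ≤ q) {l : Ln} {y : Pt} (h : ¬ S.pl y l) :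
    ∃ H, S.lh l H ∧ ¬ S.ph y H := by
  obtain ⟨H, h1, h2⟩ := S.span h
  obtain ⟨G, h3, h4⟩ := S.exists_plane_on_ne hq l H
  exact ⟨G, h3, fun h5 => h4 (S.span_unique h h3 h5 h1 h2)⟩

/-- The indicator of a set of flags. -/
def indicator (X : Set (Ln × Pt × Pl)) (l : Ln) (x : Pt) (H : Pl) : ℝ :=
  if (l, x, H) ∈ X then 1 else 0

theorem sum_indicator (X : Set (Ln × Pt × Pl)) : ∑ l, ∑ x, ∑ H, indicator X l x H = X.ncard := by
  have h := sum_indicator_eq_card (fun t : Ln × Pt × Pl => t ∈ X)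
  rw [Fintype.sum_prod_type] at h
  simp only [Fintype.sum_prod_type] at h
  exact h

theorem sum_indicator_sq (X : Set (Ln × Pt × Pl)) :
    ∑ l, ∑ x, ∑ H, indicator X l x H ^ 2 = X.ncard := by
  rw [← sum_indicator]
  refine Finset.sum_congr rfl fun l _ => Finset.sum_congr rfl fun x _ =>
    Finset.sum_congr rfl fun H _ => ?_
  unfold indicator; split_ifs <;> simp

section

variable {S} {X : Set (Ln × Pt × Pl)} (hX : ∀ t ∈ X, S.IsFlag t)
  (hopp : ∀ t ∈ X, ∀ t' ∈ X, ¬ S.Opp t t')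

include hX

theorem supportedOn_indicator (l : Ln) : S.SupportedOn l (indicator X l) :=
  ⟨fun _ _ h => if_neg fun hm => h (hX _ hm).1, fun _ _ h => if_neg fun hm => h (hX _ hm).2⟩

include hopp

theorem oppForm_indicator : S.oppForm (indicator X) = 0 := by
  refine Finset.sum_eq_zero fun l _ => Finset.sum_eq_zero fun m _ => ?_
  by_cases hd : S.Disj l m
  swap
  · simp [iDisj, hd]
  refine mul_eq_zero_of_right _ (Finset.sum_eq_zero fun x _ => Finset.sum_eq_zero fun H _ =>
    Finset.sum_eq_zero fun y _ => Finset.sum_eq_zero fun G _ => ?_)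
  by_cases h1 : (l, x, H) ∈ X
  swap
  · simp [indicator, h1]
  by_cases h2 : (m, y, G) ∈ X
  swap
  · simp [indicator, h2]
  have h3 := hopp _ h1 _ h2
  by_cases h4 : S.ph x G
  · simp [iPH, h4]
  by_cases h5 : S.ph y H
  · simp [iPH, h5]
  exact absurd ⟨hd, h4, h5⟩ h3

theorem ncard_le (hq : 1 ≤ q) : X.ncard ≤ (q ^ 2 + q + 1) * (q + 1) ^ 2 := by
  have h := S.oppForm_ge hq (supportedOn_indicator hX)
  rw [oppForm_indicator hX hopp, sum_indicator_sq, zero_add] at h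
  have h1 : ∑ l, total (indicator X l) = X.ncard := sum_indicator X
  rw [h1] at h
  have hq0 : (0 : ℝ) < q := by exact_mod_cast (by omega : 0 < q)
  have h2 : (X.ncard : ℝ) * X.ncard ≤ ((q ^ 2 + q + 1) * (q + 1) ^ 2) * X.ncard := by
    field_simp at h
    linarith
  have h3 : (X.ncard : ℝ) ≤ (q ^ 2 + q + 1) * (q + 1) ^ 2 := by
    rcases (Nat.cast_nonneg (α := ℝ) X.ncard).eq_or_lt with h0 | h0
    · rw [← h0]; positivity
    · exact le_of_mul_le_mul_right h2 h0
  exact_mod_cast h3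

/-- In the case of equality the indicator of `X` depends on the line only, and the lines of the
flags in `X` meet pairwise. -/
theorem eq_of_ncard_eq (hq : 2 ≤ q) (hcard : X.ncard = (q ^ 2 + q + 1) * (q + 1) ^ 2) :
    (∃ x, X = {t | S.IsFlag t ∧ S.pl x t.1}) ∨ ∃ H, X = {t | S.IsFlag t ∧ S.lh t.1 H} := by
  have hq0 : (0 : ℝ) < q := by exact_mod_cast (by omega : 0 < q)
  obtain ⟨g, b, hg, hf⟩ := S.exists_of_oppForm_le hq (supportedOn_indicator hX) (by
    rw [oppForm_indicator hX hopp, sum_indicator_sq]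
    have h1 : ∑ l, total (indicator X l) = X.ncard := sum_indicator X
    rw [h1, hcard]
    push_cast
    apply le_of_eq
    field_simp
    ring)
  have h01 : ∀ l x H, indicator X l x H = 0 ∨ indicator X l x H = 1 := by
    intro l x H
    unfold indicator
    split_ifs <;> simp
  have hg0 := S.eq_zero_of_zero_one hq hg hf h01
  have hgp : ∀ H, S.planeSum g H = 0 := fun H => by simp [planeSum, hg0]
  simp only [hg0, hgp] at hf
  have hXL : ∀ t, t ∈ X ↔ S.IsFlag t ∧ b t.1 = 1 := by
    rintro ⟨l, x, H⟩
    constructor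
    · intro h
      have h1 := hX _ h
      refine ⟨h1, ?_⟩
      have := hf l x H h1.1 h1.2
      rw [indicator, if_pos h] at this
      simpa using this.symm
    · rintro ⟨h1, h2⟩
      by_contra h
      have := hf l x H h1.1 h1.2
      rw [indicator, if_neg h] at this
      dsimp only at h2
      rw [h2] at this
      norm_num at this
  have hmeet : ∀ l m, b l = 1 → b m = 1 → ¬ S.Disj l m := by
    intro l m hl hm hd
    obtain ⟨x, hx⟩ := S.exists_point_on l
    obtain ⟨y, hy⟩ := S.exists_point_on m
    obtain ⟨G, hG, hxG⟩ := S.exists_plane_on_not (by omega) (hd x hx)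
    obtain ⟨H, hH, hyH⟩ := S.exists_plane_on_not (by omega) (hd.symm S y hy)
    exact hopp (l, x, H) ((hXL _).2 ⟨⟨hx, hH⟩, hl⟩) (m, y, G) ((hXL _).2 ⟨⟨hy, hG⟩, hm⟩)
      ⟨hd, hxG, hyH⟩
  have hLcard : Nat.card {l // b l = 1} = q ^ 2 + q + 1 := by
    have h1 := S.card_flags (fun l => b l = 1)
    have h2 : Nat.card {t // S.IsFlag t ∧ b t.1 = 1} = X.ncard :=
      Nat.card_congr (Equiv.subtypeEquivRight fun t => (hXL t).symm)
    rw [h2, hcard, mul_comm] at h1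
    exact (Nat.eq_of_mul_eq_mul_left (by positivity) h1).symm
  -- a set of lines contained in another one of the same size
  have heq : ∀ P : Ln → Prop, Nat.card {l // P l} = q ^ 2 + q + 1 → (∀ l, b l = 1 → P l) →
      X = {t | S.IsFlag t ∧ P t.1} := by
    intro P hP hsub
    have h1 : {l | b l = 1} = {l | P l} :=
      Set.eq_of_subset_of_ncard_le (fun l hl => hsub l hl) (hP.trans hLcard.symm).le (Set.toFinite _)
    have h2 : ∀ l, b l = 1 ↔ P l := fun l => Set.ext_iff.1 h1 l
    ext t
    rw [hXL, h2]
    rfl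
  rcases S.star_or_ruled_of_meet (by omega) hmeet with ⟨x, hx⟩ | ⟨H, hH⟩
  · exact Or.inl ⟨x, heq _ (S.card_star x) hx⟩
  · exact Or.inr ⟨H, heq (fun l => S.lh l H) (S.card_ruled H) hH⟩

end

end ProjectiveSpace3

end

/-! ### The polar form and the planes of the quadric -/

namespace KleinQuadric

open Module

variable {K : Type*} [Field K]

/-- The polar form of the quadric. -/
def polarForm (K : Type*) [Field K] : LinearMap.BilinForm K (Fin 6 → K) := (hypForm K).polarBilin

theorem hypForm_add (x y : Fin 6 → K) :
    hypForm K (x + y) = hypForm K x + hypForm K y + polarForm K x y := by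
  simp [polarForm, QuadraticMap.polar]

theorem polarForm_apply (x y : Fin 6 → K) : polarForm K x y =
    x 0 * y 1 + x 1 * y 0 + (x 2 * y 3 + x 3 * y 2) + (x 4 * y 5 + x 5 * y 4) := by
  have := hypForm_add x y
  simp only [hypForm_apply, Pi.add_apply] at this
  linear_combination -this

theorem polarForm_comm (x y : Fin 6 → K) : polarForm K x y = polarForm K y x := by
  simp only [polarForm_apply]; ring

theorem polarForm_isRefl : (polarForm K).IsRefl := fun x y h => by rw [polarForm_comm, h]

theorem polarForm_nondegenerate : (polarForm K).Nondegenerate := by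
  have h : ∀ x : Fin 6 → K, (∀ y, polarForm K x y = 0) → x = 0 := by
    intro x hx
    have h0 := hx (Pi.single 0 1)
    have h1 := hx (Pi.single 1 1)
    have h2 := hx (Pi.single 2 1)
    have h3 := hx (Pi.single 3 1)
    have h4 := hx (Pi.single 4 1)
    have h5 := hx (Pi.single 5 1)
    simp [polarForm_apply] at h0 h1 h2 h3 h4 h5
    funext i
    fin_cases i <;> simp [*]
  exact ⟨h, fun x hx => h x fun y => by rw [polarForm_comm]; exact hx y⟩

/-- The orthogonal complement with respect to the polar form. -/
def perp (W : Submodule K (Fin 6 → K)) : Submodule K (Fin 6 → K) := (polarForm K).orthogonal W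

theorem finrank_perp (W : Submodule K (Fin 6 → K)) : finrank K (perp W) = 6 - finrank K W := by
  rw [perp, LinearMap.BilinForm.finrank_orthogonal polarForm_nondegenerate]
  simp

theorem perp_perp (W : Submodule K (Fin 6 → K)) : perp (perp W) = W :=
  LinearMap.BilinForm.orthogonal_orthogonal polarForm_nondegenerate polarForm_isRefl W

theorem perp_anti {U W : Submodule K (Fin 6 → K)} (h : U ≤ W) : perp W ≤ perp U :=
  LinearMap.BilinForm.orthogonal_le h

theorem le_perp_comm {U W : Submodule K (Fin 6 → K)} (h : U ≤ perp W) : W ≤ perp U :=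
  fun w hw u hu => by rw [polarForm_comm]; exact h hu w hw

theorem perp_sup (U W : Submodule K (Fin 6 → K)) : perp (U ⊔ W) = perp U ⊓ perp W := by
  apply le_antisymm
  · exact le_inf (perp_anti le_sup_left) (perp_anti le_sup_right)
  · apply le_perp_comm
    exact sup_le (le_perp_comm inf_le_left) (le_perp_comm inf_le_right)

theorem OnQuadric.mono {U W : Submodule K (Fin 6 → K)} (hW : OnQuadric W) (h : U ≤ W) :
    OnQuadric U := fun x hx => hW x (h hx)

theorem OnQuadric.le_perp {W : Submodule K (Fin 6 → K)} (hW : OnQuadric W) : W ≤ perp W := by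
  intro x hx w hw
  have := hypForm_add w x
  rw [hW _ (W.add_mem hw hx), hW w hw, hW x hx] at this
  simpa using this.symm

theorem OnQuadric.sup {U W : Submodule K (Fin 6 → K)} (hU : OnQuadric U) (hW : OnQuadric W)
    (h : W ≤ perp U) : OnQuadric (U ⊔ W) := by
  intro x hx
  obtain ⟨u, hu, w, hw, rfl⟩ := Submodule.mem_sup.1 hx
  rw [hypForm_add, hU u hu, hW w hw, h hw u hu]
  simp

theorem onQuadric_span {x : Fin 6 → K} (hx : hypForm K x = 0) :
    OnQuadric (Submodule.span K {x}) := by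
  intro y hy
  obtain ⟨c, rfl⟩ := Submodule.mem_span_singleton.1 hy
  rw [QuadraticMap.map_smul, hx]; simp

theorem exists_mem_not_mem {U W : Submodule K (Fin 6 → K)} (h : finrank K U < finrank K W) :
    ∃ x ∈ W, x ∉ U := by
  by_contra! hc
  exact absurd (Submodule.finrank_mono (show W ≤ U from hc)) (by omega)

theorem IsPlane.perp_eq {W : Submodule K (Fin 6 → K)} (hW : IsPlane W) : perp W = W := by
  refine (Submodule.eq_of_le_of_finrank_le hW.2.le_perp ?_).symm
  rw [finrank_perp, hW.1]

theorem IsPlane.eq_of_le {U W : Submodule K (Fin 6 → K)} (hU : IsPlane U) (hW : IsPlane W)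
    (h : U ≤ W) : U = W := Submodule.eq_of_le_of_finrank_le h (by rw [hU.1, hW.1])

theorem IsPlane.finrank_inf_lt {U W : Submodule K (Fin 6 → K)} (hU : IsPlane U) (hW : IsPlane W)
    (h : U ≠ W) : finrank K ↥(U ⊓ W) < 3 := by
  by_contra! hc
  have h1 : U ⊓ W = U := Submodule.eq_of_le_of_finrank_le inf_le_left (by rw [hU.1]; exact hc)
  exact h (hU.eq_of_le hW (inf_eq_left.1 h1))

/-- The dimension of the part of a plane orthogonal to a subspace. -/
theorem IsPlane.finrank_inf_perp {W : Submodule K (Fin 6 → K)} (hW : IsPlane W)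
    (L : Submodule K (Fin 6 → K)) :
    finrank K ↥(W ⊓ perp L) + finrank K L = 3 + finrank K ↥(W ⊓ L) := by
  have h1 : W ⊓ perp L = perp (W ⊔ L) := by rw [perp_sup, hW.perp_eq]
  have h2 := Submodule.finrank_sup_add_finrank_inf_eq W L
  have h3 : finrank K ↥(W ⊔ L) ≤ 6 := by
    have := Submodule.finrank_le (W ⊔ L)
    simpa using this
  rw [h1, finrank_perp]
  rw [hW.1] at h2
  omega

/-- The projection of a plane `W` to a totally singular subspace `L` is a plane on `L`. -/
theorem IsPlane.project {W L : Submodule K (Fin 6 → K)} (hW : IsPlane W) (hL : OnQuadric L) :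
    IsPlane ((W ⊓ perp L) ⊔ L) := by
  refine ⟨?_, (hW.2.mono inf_le_left).sup hL (le_perp_comm inf_le_right)⟩
  have h1 := Submodule.finrank_sup_add_finrank_inf_eq (W ⊓ perp L) L
  have h2 := hW.finrank_inf_perp L
  have h3 : W ⊓ perp L ⊓ L = W ⊓ L := by
    rw [inf_assoc, inf_eq_right.2 hL.le_perp]
  rw [h3] at h1
  omega

theorem inf_eq_of_line {U W L : Submodule K (Fin 6 → K)} (hU : IsPlane U) (hW : IsPlane W)
    (hne : U ≠ W) (hL : finrank K L = 2) (h1 : L ≤ U) (h2 : L ≤ W) : U ⊓ W = L := by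
  have := hU.finrank_inf_lt hW hne
  exact (Submodule.eq_of_le_of_finrank_le (le_inf h1 h2) (by omega)).symm

/-- A line on a plane of the quadric is on exactly one further plane. -/
theorem exists_second_plane {U L : Submodule K (Fin 6 → K)} (hU : IsPlane U)
    (hL : finrank K L = 2) (hLU : L ≤ U) :
    ∃ U', IsPlane U' ∧ U ⊓ U' = L ∧ ∀ W, IsPlane W → L ≤ W → W = U ∨ W = U' := by
  have hLq : OnQuadric L := hU.2.mono hLU
  obtain ⟨u, huU, huL⟩ := exists_mem_not_mem (U := L) (W := U) (by rw [hL, hU.1]; norm_num)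
  have hQu : hypForm K u = 0 := hU.2 u huU
  obtain ⟨w, hw, hwu⟩ : ∃ w ∈ perp L, polarForm K w u ≠ 0 := by
    by_contra! hc
    exact huL (by rw [← perp_perp L]; exact hc)
  -- a singular vector orthogonal to `L` and not to `u`
  obtain ⟨v, hvL, hvu⟩ : ∃ v ∈ perp L, polarForm K v u = 1 :=
    ⟨(polarForm K w u)⁻¹ • w, (perp L).smul_mem _ hw, by
      rw [LinearMap.BilinForm.smul_left, inv_mul_cancel₀ hwu]⟩
  have huu : polarForm K u u = 0 := hU.2.le_perp huU u huU
  set z := v + (-hypForm K v) • u with hz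
  have hzu : polarForm K z u = 1 := by
    rw [hz, LinearMap.BilinForm.add_left, LinearMap.BilinForm.smul_left, hvu, huu]; simp
  have hzq : hypForm K z = 0 := by
    rw [hz, hypForm_add, QuadraticMap.map_smul, hQu, LinearMap.BilinForm.smul_right, hvu]
    simp
  have hzL : z ∈ perp L :=
    (perp L).add_mem hvL ((perp L).smul_mem _ (perp_anti hLU (hU.2.le_perp huU)))
  have hzU : z ∉ U := fun h => by
    have := hU.2.le_perp huU z h
    rw [hzu] at this
    exact one_ne_zero this
  have hzL' : z ∉ L := fun h => hzU (hLU h)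
  have hspan : Submodule.span K {z} ≤ perp L := by
    rwa [Submodule.span_singleton_le_iff_mem]
  have hU' : IsPlane (L ⊔ Submodule.span K {z}) :=
    ⟨by rw [Submodule.finrank_sup_span_singleton hzL', hL], hLq.sup (onQuadric_span hzq) hspan⟩
  have hzU' : z ∈ L ⊔ Submodule.span K {z} :=
    Submodule.mem_sup_right (Submodule.mem_span_singleton_self z)
  have hne : U ≠ L ⊔ Submodule.span K {z} := fun h => hzU (h ▸ hzU')
  refine ⟨_, hU', inf_eq_of_line hU hU' hne hL hLU le_sup_left, ?_⟩
  intro W hW hLW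
  obtain ⟨r, hrW, hrL⟩ := exists_mem_not_mem (U := L) (W := W) (by rw [hL, hW.1]; norm_num)
  -- `perp L` is spanned by `U` and `z`
  have hperp : U ⊔ Submodule.span K {z} = perp L := by
    apply Submodule.eq_of_le_of_finrank_le
    · exact sup_le (hU.2.le_perp.trans (perp_anti hLU)) hspan
    · rw [Submodule.finrank_sup_span_singleton hzU, finrank_perp, hU.1, hL]
  have hr : r ∈ U ⊔ Submodule.span K {z} := by
    rw [hperp]; exact perp_anti hLW (hW.2.le_perp hrW)
  obtain ⟨p, hp, y, hy, rfl⟩ := Submodule.mem_sup.1 hr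
  obtain ⟨c, rfl⟩ := Submodule.mem_span_singleton.1 hy
  have hQ := hW.2 _ hrW
  rw [hypForm_add, hU.2 p hp, QuadraticMap.map_smul, hzq, LinearMap.BilinForm.smul_right] at hQ
  have hQ' : c * polarForm K p z = 0 := by simpa using hQ
  have huniq : ∀ {W'}, IsPlane W' → L ≤ W' → p + c • z ∈ W' → W = W' := by
    intro W' hW' hLW' hr'
    by_contra hne'
    have := inf_eq_of_line hW hW' hne' hL hLW hLW'
    exact hrL (this ▸ Submodule.mem_inf.2 ⟨hrW, hr'⟩)
  rcases mul_eq_zero.1 hQ' with hc | hc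
  · left
    exact huniq hU hLU (by rw [hc]; simpa using hp)
  · right
    refine huniq hU' le_sup_left (Submodule.add_mem _ ?_ (Submodule.smul_mem _ _ hzU'))
    -- `p` is orthogonal to the second plane, hence on it
    rw [← hU'.perp_eq, perp_sup]
    refine ⟨perp_anti hLU (hU.2.le_perp hp), ?_⟩
    intro y hy
    obtain ⟨d, rfl⟩ := Submodule.mem_span_singleton.1 hy
    rw [LinearMap.BilinForm.smul_left, polarForm_comm, hc, mul_zero]

/-- Of two planes on a line, the one that contains the projection of a plane `W` meets `W` in
one dimension more than the other. -/
theorem finrank_inf_of_project {U U' L W : Submodule K (Fin 6 → K)} (hU : IsPlane U)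
    (hU' : IsPlane U') (hL : finrank K L = 2) (hUU' : U ⊓ U' = L) (hW : IsPlane W)
    (h : (W ⊓ perp L) ⊔ L = U) : finrank K ↥(W ⊓ U) = finrank K ↥(W ⊓ U') + 1 := by
  have hLU : L ≤ U := hUU' ▸ inf_le_left
  have hLU' : L ≤ U' := hUU' ▸ inf_le_right
  have h1 : W ⊓ U = W ⊓ perp L := by
    apply le_antisymm
    · exact inf_le_inf_left _ (hU.2.le_perp.trans (perp_anti hLU))
    · exact le_inf inf_le_left (h ▸ le_sup_left)
  have h2 : W ⊓ U' = W ⊓ L := by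
    apply le_antisymm
    · refine le_inf inf_le_left ?_
      rw [← hUU']
      refine le_inf ?_ inf_le_right
      refine le_trans ?_ (inf_le_right (a := W))
      rw [h1]
      exact inf_le_inf_left _ (hU'.2.le_perp.trans (perp_anti hLU'))
    · exact inf_le_inf_left _ hLU'
  have h3 := hW.finrank_inf_perp L
  rw [h1, h2]
  omega

/-- Adjacent planes meet every plane in dimensions of different parity. -/
theorem odd_of_adjacent {U U' W : Submodule K (Fin 6 → K)} (hU : IsPlane U) (hU' : IsPlane U')
    (h : finrank K ↥(U ⊓ U') = 2) (hW : IsPlane W) :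
    Odd (finrank K ↥(W ⊓ U) + finrank K ↥(W ⊓ U')) := by
  obtain ⟨U'', hU'', h1, h2⟩ := exists_second_plane hU h inf_le_left
  have hne : U' ≠ U := by
    rintro rfl
    rw [inf_idem, hU.1] at h
    omega
  have h3 : U' = U'' := (h2 U' hU' inf_le_right).resolve_left hne
  subst h3
  rcases h2 _ (hW.project (hU.2.mono inf_le_left)) le_sup_right with h4 | h4
  · have := finrank_inf_of_project hU hU' h rfl hW h4
    rw [Nat.odd_iff]; omega
  · rw [inf_comm U U'] at h4 h
    have := finrank_inf_of_project hU' hU h rfl hW h4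
    rw [Nat.odd_iff]; omega

theorem finrank_inf_eq_zero_of_point {P U : Submodule K (Fin 6 → K)} (hP : finrank K P = 1)
    (h : ¬ P ≤ U) : finrank K ↥(U ⊓ P) = 0 := by
  have h1 := Submodule.finrank_mono (inf_le_right : U ⊓ P ≤ P)
  by_contra h2
  have : U ⊓ P = P := Submodule.eq_of_le_of_finrank_le inf_le_right (by omega)
  exact h (inf_eq_right.1 this)

/-- The plane on a point `P` that meets a plane `U` not on `P` in a line. -/
theorem finrank_inf_project {P U : Submodule K (Fin 6 → K)} (hP : IsPoint P) (hU : IsPlane U)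
    (h : ¬ P ≤ U) : finrank K ↥(U ⊓ perp P) = 2 ∧ U ⊓ ((U ⊓ perp P) ⊔ P) = U ⊓ perp P := by
  have h1 := hU.finrank_inf_perp P
  rw [finrank_inf_eq_zero_of_point hP.1 h, hP.1] at h1
  have h2 : finrank K ↥(U ⊓ perp P) = 2 := by omega
  exact ⟨h2, inf_eq_of_line hU (hU.project hP.2) (fun e => h (e ▸ le_sup_right)) h2 inf_le_left
    le_sup_left⟩

theorem isPoint_span {W : Submodule K (Fin 6 → K)} (hW : OnQuadric W) {x : Fin 6 → K}
    (hx : x ∈ W) (hx0 : x ≠ 0) : IsPoint (Submodule.span K {x}) :=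
  ⟨finrank_span_singleton hx0, onQuadric_span (hW x hx)⟩

/-- The dimensions in which three planes meet pairwise have an odd sum: being equal or meeting in
a point is an equivalence relation with two classes. -/
theorem odd_finrank_inf {U V W : Submodule K (Fin 6 → K)} (hU : IsPlane U) (hV : IsPlane V)
    (hW : IsPlane W) :
    Odd (finrank K ↥(U ⊓ V) + finrank K ↥(U ⊓ W) + finrank K ↥(V ⊓ W)) := by
  induction hn : 3 - finrank K ↥(U ⊓ V) using Nat.strong_induction_on generalizing U with
  | _ n ih =>
    by_cases hUV : U = V
    · subst hUV
      rw [inf_idem, hU.1, Nat.odd_iff]; omega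
    have hlt := hU.finrank_inf_lt hV hUV
    obtain ⟨x, hxV, hxUV⟩ := exists_mem_not_mem (U := U ⊓ V) (W := V) (by rw [hV.1]; exact hlt)
    have hxU : x ∉ U := fun h => hxUV ⟨h, hxV⟩
    have hx0 : x ≠ 0 := fun h => hxU (h ▸ U.zero_mem)
    set P := Submodule.span K {x} with hP
    have hPp : IsPoint P := isPoint_span hV.2 hxV hx0
    have hPV : P ≤ V := by rwa [hP, Submodule.span_singleton_le_iff_mem]
    have hPU : ¬ P ≤ U := by rwa [hP, Submodule.span_singleton_le_iff_mem]
    obtain ⟨h1, h2⟩ := finrank_inf_project hPp hU hPU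
    set U' := (U ⊓ perp P) ⊔ P with hU'
    have hU'p : IsPlane U' := hU.project hPp.2
    have h3 : finrank K ↥(U ⊓ U') = 2 := by rw [h2, h1]
    have h4 : finrank K ↥(U ⊓ V) + 1 ≤ finrank K ↥(U' ⊓ V) := by
      rw [← Submodule.finrank_sup_span_singleton hxUV]
      refine Submodule.finrank_mono (sup_le (le_inf (le_trans ?_ le_sup_left) inf_le_right)
        (le_inf le_sup_right hPV))
      exact le_inf inf_le_left (inf_le_right.trans (hV.2.le_perp.trans (perp_anti hPV)))
    have h5 := ih (3 - finrank K ↥(U' ⊓ V)) (by omega) hU'p rfl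
    have h6 := odd_of_adjacent hU hU'p h3 hW
    have h7 := odd_of_adjacent hU hU'p h3 hV
    rw [inf_comm W, inf_comm W] at h6
    rw [inf_comm V, inf_comm V] at h7
    rw [Nat.odd_iff] at *
    omega

theorem isPlane_basePlane : IsPlane (basePlane K) := by
  have hq : OnQuadric (basePlane K) := by
    rintro x ⟨h1, h2, h3⟩
    simp [hypForm_apply, h1, h2, h3]
  refine ⟨?_, hq⟩
  have h : perp (basePlane K) = basePlane K := by
    refine le_antisymm (fun x hx => ?_) hq.le_perp
    have h0 := hx (Pi.single 0 1) (by simp [basePlane])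
    have h2 := hx (Pi.single 2 1) (by simp [basePlane])
    have h4 := hx (Pi.single 4 1) (by simp [basePlane])
    simp [polarForm_apply] at h0 h2 h4
    exact ⟨h0, h2, h4⟩
  have h1 := finrank_perp (basePlane K)
  rw [h] at h1
  omega

/-! ### The two families of planes and the Klein correspondence -/

/-- `F` and `G` are the two families of planes of the quadric, in some order. -/
structure Families (F G : Submodule K (Fin 6 → K) → Prop) : Prop where
  left : ∀ {U}, F U → IsPlane U
  right : ∀ {U}, G U → IsPlane U
  cover : ∀ {U}, IsPlane U → F U ∨ G U
  odd_left : ∀ {U V}, F U → F V → Odd (finrank K ↥(U ⊓ V))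
  odd_right : ∀ {U V}, G U → G V → Odd (finrank K ↥(U ⊓ V))
  even : ∀ {U V}, F U → G V → Even (finrank K ↥(U ⊓ V))

theorem families_greek_latin : Families (K := K) IsGreek IsLatin where
  left h := h.1
  right h := h.1
  cover {U} h := by
    rcases Nat.even_or_odd (finrank K ↥(U ⊓ basePlane K)) with h1 | h1
    · exact Or.inr ⟨h, h1⟩
    · exact Or.inl ⟨h, h1⟩
  odd_left {U V} h1 h2 := by
    have h := odd_finrank_inf h1.1 h2.1 isPlane_basePlane
    have h3 := h1.2
    have h4 := h2.2
    rw [Nat.odd_iff] at *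
    omega
  odd_right {U V} h1 h2 := by
    have h := odd_finrank_inf h1.1 h2.1 isPlane_basePlane
    have h3 := h1.2
    have h4 := h2.2
    rw [Nat.odd_iff] at *
    rw [Nat.even_iff] at *
    omega
  even {U V} h1 h2 := by
    have h := odd_finrank_inf h1.1 h2.1 isPlane_basePlane
    have h3 := h1.2
    have h4 := h2.2
    rw [Nat.odd_iff] at *
    rw [Nat.even_iff] at *
    omega

namespace Families

variable {F G : Submodule K (Fin 6 → K) → Prop}

theorem swap (h : Families F G) : Families G F where
  left := h.right
  right := h.left
  cover hU := (h.cover hU).symm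
  odd_left := h.odd_right
  odd_right := h.odd_left
  even h1 h2 := by rw [inf_comm]; exact h.even h2 h1

variable (h : Families F G)

include h

theorem finrank_inf_eq_two {U V : Submodule K (Fin 6 → K)} (hU : F U) (hV : G V)
    (hne : U ⊓ V ≠ ⊥) : finrank K ↥(U ⊓ V) = 2 := by
  have h1 := h.even hU hV
  have h2 : finrank K ↥(U ⊓ V) ≠ 0 := fun h0 => hne (Submodule.finrank_eq_zero.1 h0)
  have h3 := Submodule.finrank_mono (inf_le_left : U ⊓ V ≤ U)
  rw [(h.left hU).1] at h3
  rw [Nat.even_iff] at h1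
  omega

theorem finrank_inf_eq_one {U V : Submodule K (Fin 6 → K)} (hU : F U) (hV : F V)
    (hne : U ≠ V) : finrank K ↥(U ⊓ V) = 1 := by
  have h1 := h.odd_left hU hV
  have h3 := (h.left hU).finrank_inf_lt (h.left hV) hne
  rw [Nat.odd_iff] at h1
  omega

theorem right_of_even {U V : Submodule K (Fin 6 → K)} (hU : F U) (hV : IsPlane V)
    (he : finrank K ↥(U ⊓ V) = 2) : G V := by
  refine (h.cover hV).resolve_left fun hF => ?_
  have := h.odd_left hU hF
  rw [he, Nat.odd_iff] at this
  omega

theorem exists_on_line {L : Submodule K (Fin 6 → K)} (hL : IsLine L) : ∃ U, F U ∧ L ≤ U := by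
  obtain ⟨V, hV, hLV⟩ : ∃ V, IsPlane V ∧ L ≤ V :=
    ⟨_, isPlane_basePlane.project hL.2, le_sup_right⟩
  rcases h.cover hV with hF | hG
  · exact ⟨V, hF, hLV⟩
  · obtain ⟨U, hU, h1, -⟩ := exists_second_plane hV hL.1 hLV
    exact ⟨U, h.swap.right_of_even hG hU (by rw [h1, hL.1]), h1 ▸ inf_le_right⟩

theorem eq_of_line {L U V : Submodule K (Fin 6 → K)} (hL : finrank K L = 2) (hU : F U) (hV : F V)
    (h1 : L ≤ U) (h2 : L ≤ V) : U = V := by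
  by_contra hne
  have h3 := h.finrank_inf_eq_one hU hV hne
  have h4 := Submodule.finrank_mono (le_inf h1 h2)
  omega

theorem isPoint_inf {U V : Submodule K (Fin 6 → K)} (hU : F U) (hV : F V) (hne : U ≠ V) :
    IsPoint (U ⊓ V) :=
  ⟨h.finrank_inf_eq_one hU hV hne, (h.left hU).2.mono inf_le_left⟩

theorem eq_inf_of_point {U V P : Submodule K (Fin 6 → K)} (hU : F U) (hV : F V) (hne : U ≠ V)
    (hP : IsPoint P) (h1 : P ≤ U) (h2 : P ≤ V) : P = U ⊓ V :=
  Submodule.eq_of_le_of_finrank_le (le_inf h1 h2) (by rw [h.finrank_inf_eq_one hU hV hne, hP.1])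

theorem exists_span {U P : Submodule K (Fin 6 → K)} (hU : F U) (hP : IsPoint P) (hPU : ¬ P ≤ U) :
    ∃ V, G V ∧ P ≤ V ∧ U ⊓ V ≠ ⊥ := by
  obtain ⟨h1, h2⟩ := finrank_inf_project hP (h.left hU) hPU
  have h3 : finrank K ↥(U ⊓ ((U ⊓ perp P) ⊔ P)) = 2 := by rw [h2, h1]
  refine ⟨_, h.right_of_even hU ((h.left hU).project hP.2) h3, le_sup_right, fun h0 => ?_⟩
  rw [h0, finrank_bot] at h3
  omega

theorem span_unique {U V V' P : Submodule K (Fin 6 → K)} (hU : F U) (hP : IsPoint P)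
    (hPU : ¬ P ≤ U) (hV : G V) (hV' : G V') (h1 : P ≤ V) (h2 : U ⊓ V ≠ ⊥) (h3 : P ≤ V')
    (h4 : U ⊓ V' ≠ ⊥) : V = V' := by
  have h5 := (finrank_inf_project hP (h.left hU) hPU).1
  have key : ∀ {V}, G V → P ≤ V → U ⊓ V ≠ ⊥ → (U ⊓ perp P) ≤ V := by
    intro V hV h1 h2
    have h6 : U ⊓ V = U ⊓ perp P := by
      apply Submodule.eq_of_le_of_finrank_le
      · exact inf_le_inf_left _ ((h.right hV).2.le_perp.trans (perp_anti h1))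
      · rw [h5, h.finrank_inf_eq_two hU hV h2]
    exact h6 ▸ inf_le_right
  exact h.swap.eq_of_line h5 hV hV' (key hV h1 h2) (key hV' h3 h4)

theorem le_of_two {U U' V P : Submodule K (Fin 6 → K)} (hU : F U) (hU' : F U') (hne : U ≠ U')
    (hP : IsPoint P) (h1 : P ≤ U) (h2 : P ≤ U') (hV : G V) (h3 : U ⊓ V ≠ ⊥) (h4 : U' ⊓ V ≠ ⊥) :
    P ≤ V := by
  have e1 := h.finrank_inf_eq_two hU hV h3
  have e2 := h.finrank_inf_eq_two hU' hV h4
  have e3 := Submodule.finrank_sup_add_finrank_inf_eq (U ⊓ V) (U' ⊓ V)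
  have e4 := Submodule.finrank_mono (sup_le inf_le_right inf_le_right : U ⊓ V ⊔ U' ⊓ V ≤ V)
  rw [(h.right hV).1] at e4
  have e5 : U ⊓ V ⊓ (U' ⊓ V) ≤ U ⊓ U' := inf_le_inf inf_le_left inf_le_left
  have e6 : U ⊓ V ⊓ (U' ⊓ V) = U ⊓ U' :=
    Submodule.eq_of_le_of_finrank_le e5 (by rw [h.finrank_inf_eq_one hU hU' hne]; omega)
  rw [h.eq_inf_of_point hU hU' hne hP h1 h2, ← e6]
  exact inf_le_left.trans inf_le_right

end Families

theorem inf_ne_bot_of_point {U V P : Submodule K (Fin 6 → K)} (hP : IsPoint P) (h1 : P ≤ U)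
    (h2 : P ≤ V) : U ⊓ V ≠ ⊥ := by
  intro h0
  have := Submodule.finrank_mono (le_inf h1 h2)
  rw [h0, finrank_bot, hP.1] at this
  omega

/-- The number of points of a subspace on the quadric. -/
theorem card_points_le [Finite K] {W : Submodule K (Fin 6 → K)} (hW : OnQuadric W) :
    Nat.card {P : {P : Submodule K (Fin 6 → K) // IsPoint P} // P.1 ≤ W} =
      ∑ i ∈ Finset.range (finrank K W), Nat.card K ^ i := by
  rw [← Projectivization.card_of_finrank K W rfl,
    Nat.card_congr (Projectivization.equivSubmodule K W)]
  symm
  refine Nat.card_eq_of_bijective (fun H => ⟨⟨H.1.map W.subtype, ?_, ?_⟩, ?_⟩) ⟨?_, ?_⟩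
  · rw [Submodule.finrank_map_subtype_eq]; exact H.2
  · exact hW.mono (Submodule.map_subtype_le W H.1)
  · exact Submodule.map_subtype_le W H.1
  · intro H H' hHH
    exact Subtype.ext (Submodule.map_injective_of_injective W.injective_subtype
      (congrArg (fun P => P.1.1) hHH))
  · rintro ⟨⟨P, hP⟩, hPW⟩
    have h1 : (P.comap W.subtype).map W.subtype = P := by
      rw [Submodule.map_comap_subtype]; exact inf_eq_right.2 hPW
    refine ⟨⟨P.comap W.subtype, ?_⟩, ?_⟩
    · rw [← Submodule.finrank_map_subtype_eq, h1]; exact hP.1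
    · simp only [h1]

theorem card_points_two [Finite K] {W : Submodule K (Fin 6 → K)} (hW : OnQuadric W)
    (h : finrank K W = 2) :
    Nat.card {P : {P : Submodule K (Fin 6 → K) // IsPoint P} // P.1 ≤ W} = Nat.card K + 1 := by
  rw [card_points_le hW, h]
  simp [Finset.sum_range_succ]; ring

theorem card_points_three [Finite K] {W : Submodule K (Fin 6 → K)} (hW : OnQuadric W)
    (h : finrank K W = 3) :
    Nat.card {P : {P : Submodule K (Fin 6 → K) // IsPoint P} // P.1 ≤ W} =
      Nat.card K ^ 2 + Nat.card K + 1 := by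
  rw [card_points_le hW, h]
  simp [Finset.sum_range_succ]; ring

theorem finrank_sup_of_points {P Q : Submodule K (Fin 6 → K)} (hP : finrank K P = 1)
    (hQ : finrank K Q = 1) (hne : P ≠ Q) : finrank K ↥(P ⊔ Q) = 2 := by
  have h1 := Submodule.finrank_sup_add_finrank_inf_eq P Q
  have h2 : finrank K ↥(P ⊓ Q) = 0 := by
    refine finrank_inf_eq_zero_of_point hQ fun hle => hne ?_
    exact (Submodule.eq_of_le_of_finrank_le hle (by rw [hP, hQ])).symm
  omega

theorem exists_line_of_plane {U P : Submodule K (Fin 6 → K)} (hU : IsPlane U)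
    (hP : finrank K P = 1) (hPU : P ≤ U) : ∃ L, IsLine L ∧ P ≤ L ∧ L ≤ U := by
  obtain ⟨x, hx, hxP⟩ := exists_mem_not_mem (U := P) (W := U) (by rw [hP, hU.1]; norm_num)
  have h1 : P ⊔ Submodule.span K {x} ≤ U :=
    sup_le hPU (by rwa [Submodule.span_singleton_le_iff_mem])
  exact ⟨_, ⟨by rw [Submodule.finrank_sup_span_singleton hxP, hP], hU.2.mono h1⟩, le_sup_left, h1⟩

namespace Families

variable {F G : Submodule K (Fin 6 → K) → Prop} (h : Families F G)

include h

theorem exists_on_point {P : Submodule K (Fin 6 → K)} (hP : IsPoint P) : ∃ U, F U ∧ P ≤ U := by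
  obtain ⟨V, hV, hPV⟩ : ∃ V, IsPlane V ∧ P ≤ V :=
    ⟨_, isPlane_basePlane.project hP.2, le_sup_right⟩
  obtain ⟨L, hL, hPL, -⟩ := exists_line_of_plane hV hP.1 hPV
  obtain ⟨U, hU, hLU⟩ := h.exists_on_line hL
  exact ⟨U, hU, hPL.trans hLU⟩

/-- The planes of one family on a point `P` correspond to the points of a line opposite to `P` in
a plane of the other family. -/
theorem card_on_point [Finite K] {P : Submodule K (Fin 6 → K)} (hP : IsPoint P) :
    Nat.card {U : {U // F U} // P ≤ U.1} = Nat.card K + 1 := by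
  obtain ⟨V, hV, hPV⟩ := h.swap.exists_on_point hP
  have hVp := h.right hV
  -- a line of `V` not on `P`
  obtain ⟨m, hmV, hm, hPm, hsup⟩ : ∃ m ≤ V, finrank K m = 2 ∧ ¬ P ≤ m ∧ P ⊔ m = V := by
    obtain ⟨C, hC⟩ := Submodule.exists_isCompl P
    have h1 : P ⊔ C ⊓ V = V := by
      rw [← sup_inf_assoc_of_le C hPV, hC.sup_eq_top, top_inf_eq]
    have h2 : P ⊓ (C ⊓ V) = ⊥ := by rw [← inf_assoc, hC.inf_eq_bot, bot_inf_eq]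
    have h3 := Submodule.finrank_sup_add_finrank_inf_eq P (C ⊓ V)
    rw [h1, h2, finrank_bot, hVp.1, hP.1] at h3
    refine ⟨C ⊓ V, inf_le_right, by omega, fun hle => ?_, h1⟩
    rw [inf_eq_left.2 hle] at h2
    have := hP.1
    rw [h2, finrank_bot] at this
    omega
  have hm2 : ∀ {U}, F U → P ≤ U → finrank K ↥(U ⊓ m) = 1 := by
    intro U hU hPU
    have h1 := h.finrank_inf_eq_two hU hV (inf_ne_bot_of_point hP hPU hPV)
    have h2 := Submodule.finrank_sup_add_finrank_inf_eq (U ⊓ V) m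
    have h3 := Submodule.finrank_mono (sup_le inf_le_right hmV : U ⊓ V ⊔ m ≤ V)
    rw [inf_assoc, inf_eq_right.2 hmV] at h2
    rw [hVp.1] at h3
    have h4 := Submodule.finrank_mono (inf_le_right : U ⊓ m ≤ m)
    have h5 : finrank K ↥(U ⊓ m) ≠ 2 := by
      intro h5
      have h6 : U ⊓ m = m := Submodule.eq_of_le_of_finrank_le inf_le_right (by rw [h5, hm])
      have h7 : V ≤ U := hsup ▸ sup_le hPU (inf_eq_right.1 h6)
      rw [inf_eq_right.2 h7, hVp.1] at h1
      omega
    omega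
  have hne : ∀ {Q}, Q ≤ m → P ≠ Q := fun hQ e => hPm (e ▸ hQ)
  rw [← card_points_two (hVp.2.mono hmV) hm]
  refine Nat.card_eq_of_bijective (fun U => ⟨⟨U.1.1 ⊓ m, hm2 U.1.2 U.2,
    (hVp.2.mono hmV).mono inf_le_right⟩, inf_le_right⟩) ⟨?_, ?_⟩
  · rintro ⟨⟨U, hU⟩, hPU⟩ ⟨⟨U', hU'⟩, hPU'⟩ heq
    have heq' : U ⊓ m = U' ⊓ m := congrArg (fun P => P.1.1) heq
    refine Subtype.ext (Subtype.ext ?_)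
    refine h.eq_of_line (finrank_sup_of_points hP.1 (hm2 hU hPU) (hne inf_le_right)) hU hU'
      (sup_le hPU inf_le_left) (sup_le hPU' ?_)
    exact heq' ▸ inf_le_left
  · rintro ⟨⟨Q, hQ⟩, hQm⟩
    have hL : IsLine (P ⊔ Q) := ⟨finrank_sup_of_points hP.1 hQ.1 (hne hQm),
      hVp.2.mono (sup_le hPV (hQm.trans hmV))⟩
    obtain ⟨U, hU, hLU⟩ := h.exists_on_line hL
    refine ⟨⟨⟨U, hU⟩, le_sup_left.trans hLU⟩, ?_⟩
    refine Subtype.ext (Subtype.ext ?_)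
    refine (Submodule.eq_of_le_of_finrank_le (le_inf (le_sup_right.trans hLU) hQm) ?_).symm
    rw [hm2 hU (le_sup_left.trans hLU), hQ.1]

end Families

/-- The Klein correspondence: the Greek planes, the points and the Latin planes of the quadric are
the points, the lines and the planes of a projective space of dimension three. -/
def kleinSpace (K : Type*) [Field K] [Finite K] :
    ProjectiveSpace3 {U : Submodule K (Fin 6 → K) // IsGreek U}
      {P : Submodule K (Fin 6 → K) // IsPoint P} {V : Submodule K (Fin 6 → K) // IsLatin V}
      (Nat.card K) where
  pl U P := P.1 ≤ U.1
  lh P V := P.1 ≤ V.1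
  ph U V := U.1 ⊓ V.1 ≠ ⊥
  nonempty_line := by
    obtain ⟨x, hx, hx0⟩ := exists_mem_not_mem (U := ⊥) (W := basePlane K)
      (by rw [isPlane_basePlane.1, finrank_bot]; norm_num)
    exact ⟨⟨_, isPoint_span isPlane_basePlane.2 hx hx0⟩⟩
  card_points P := families_greek_latin.card_on_point P.2
  card_planes P := families_greek_latin.swap.card_on_point P.2
  trans {U P V} h1 h2 := inf_ne_bot_of_point P.2 h1 h2
  join {U U'} hne := ⟨⟨_, families_greek_latin.isPoint_inf U.2 U'.2
    fun e => hne (Subtype.ext e)⟩, inf_le_left, inf_le_right⟩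
  join_unique {U U' P Q} hne h1 h2 h3 h4 := by
    have hne' : U.1 ≠ U'.1 := fun e => hne (Subtype.ext e)
    exact Subtype.ext ((families_greek_latin.eq_inf_of_point U.2 U'.2 hne' P.2 h1 h2).trans
      (families_greek_latin.eq_inf_of_point U.2 U'.2 hne' Q.2 h3 h4).symm)
  meet {U U'} hne := ⟨⟨_, families_greek_latin.swap.isPoint_inf U.2 U'.2
    fun e => hne (Subtype.ext e)⟩, inf_le_left, inf_le_right⟩
  meet_unique {U U' P Q} hne h1 h2 h3 h4 := by
    have hne' : U.1 ≠ U'.1 := fun e => hne (Subtype.ext e)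
    exact Subtype.ext ((families_greek_latin.swap.eq_inf_of_point U.2 U'.2 hne' P.2 h1 h2).trans
      (families_greek_latin.swap.eq_inf_of_point U.2 U'.2 hne' Q.2 h3 h4).symm)
  span {U P} hPU := by
    obtain ⟨V, hV, h1, h2⟩ := families_greek_latin.exists_span U.2 P.2 hPU
    exact ⟨⟨V, hV⟩, h1, h2⟩
  span_unique {U P V V'} hPU h1 h2 h3 h4 :=
    Subtype.ext (families_greek_latin.span_unique U.2 P.2 hPU V.2 V'.2 h1 h2 h3 h4)
  cut {P V} hPV := by
    obtain ⟨U, hU, h1, h2⟩ := families_greek_latin.swap.exists_span V.2 P.2 hPV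
    exact ⟨⟨U, hU⟩, h1, by rwa [inf_comm]⟩
  cut_unique {P V U U'} hPV h1 h2 h3 h4 :=
    Subtype.ext (families_greek_latin.swap.span_unique V.2 P.2 hPV U.2 U'.2 h1
      (by rwa [inf_comm]) h3 (by rwa [inf_comm]))
  line_in {U U' P V} hne h1 h2 h3 h4 :=
    families_greek_latin.le_of_two U.2 U'.2 (fun e => hne (Subtype.ext e)) P.2 h1 h2 V.2 h3 h4
  line_on {U P V V'} hne h1 h2 h3 h4 :=
    families_greek_latin.swap.le_of_two V.2 V'.2 (fun e => hne (Subtype.ext e)) P.2 h1 h2 U.2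
      (by rwa [inf_comm]) (by rwa [inf_comm])
  card_pencil {U V} hUV := by
    rw [← card_points_two (U.2.1.2.mono inf_le_left)
      (families_greek_latin.finrank_inf_eq_two U.2 V.2 hUV)]
    exact Nat.card_congr (Equiv.subtypeEquivRight fun P => le_inf_iff.symm)
  card_star U := card_points_three U.2.1.2 U.2.1.1
  card_ruled V := card_points_three V.2.1.2 V.2.1.1

/-- The flag of the projective space that corresponds to a chamber of the quadric. -/
def Chamber.toFlag (c : Chamber K) : {P : Submodule K (Fin 6 → K) // IsPoint P} ×
    {U : Submodule K (Fin 6 → K) // IsGreek U} × {V : Submodule K (Fin 6 → K) // IsLatin V} :=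
  (⟨c.point, c.isPoint⟩, ⟨c.greek, c.isGreek⟩, ⟨c.latin, c.isLatin⟩)

theorem Chamber.toFlag_injective : Function.Injective (Chamber.toFlag (K := K)) := by
  intro c d hcd
  simp only [Chamber.toFlag, Prod.mk.injEq, Subtype.mk.injEq] at hcd
  exact Chamber.ext hcd.1 hcd.2.1 hcd.2.2

variable [Finite K]

theorem Chamber.isFlag_toFlag (c : Chamber K) : (kleinSpace K).IsFlag c.toFlag :=
  ⟨c.point_le_greek, c.point_le_latin⟩

theorem Chamber.exists_toFlag_eq {t} (ht : (kleinSpace K).IsFlag t) :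
    ∃ c : Chamber K, c.toFlag = t :=
  ⟨⟨t.1.1, t.2.1.1, t.2.2.1, t.1.2, t.2.1.2, t.2.2.2, ht.1, ht.2⟩, rfl⟩

/-- Chambers of opposite flags are opposite: a line of the quadric lies on a Greek plane. -/
theorem Chamber.opposite_of_opp {c d : Chamber K} (h : (kleinSpace K).Opp c.toFlag d.toFlag) :
    Opposite c d := by
  obtain ⟨h1, h2, h3⟩ := h
  refine ⟨?_, not_not.1 h2, not_not.1 h3⟩
  rintro ⟨L, hL, hc, hd⟩
  obtain ⟨U, hU, hLU⟩ := families_greek_latin.exists_on_line hL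
  exact h1 ⟨U, hU⟩ (hc.trans hLU) (hd.trans hLU)

theorem Chamber.image_toFlag (E : Submodule K (Fin 6 → K)) :
    Chamber.toFlag '' {c : Chamber K | c.point ≤ E} =
      {t | (kleinSpace K).IsFlag t ∧ t.1.1 ≤ E} := by
  ext t
  constructor
  · rintro ⟨c, hc, rfl⟩
    exact ⟨c.isFlag_toFlag, hc⟩
  · rintro ⟨h1, h2⟩
    obtain ⟨c, rfl⟩ := Chamber.exists_toFlag_eq h1
    exact ⟨c, h2, rfl⟩

end KleinQuadric

theorem mainTheorem3 {K : Type*} [Field K] [Finite K] (q : ℕ) (hK : Nat.card K = q) (hq : 43 ≤ q)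
    (X : Set (KleinQuadric.Chamber K))
    (hX : ∀ c ∈ X, ∀ d ∈ X, ¬ KleinQuadric.Opposite c d) :
    X.encard ≤ (((q ^ 2 + q + 1) * (q + 1) ^ 2 : ℕ) : ℕ∞) ∧
    (X.encard = (((q ^ 2 + q + 1) * (q + 1) ^ 2 : ℕ) : ℕ∞) ↔
      ∃ E : Submodule K (Fin 6 → K), KleinQuadric.IsPlane E ∧
        X = {c : KleinQuadric.Chamber K | c.point ≤ E}) := by
  subst hK
  let _ : Fintype {P : Submodule K (Fin 6 → K) // KleinQuadric.IsPoint P} := Fintype.ofFinite _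
  let _ : Fintype {U : Submodule K (Fin 6 → K) // KleinQuadric.IsGreek U} := Fintype.ofFinite _
  let _ : Fintype {V : Submodule K (Fin 6 → K) // KleinQuadric.IsLatin V} := Fintype.ofFinite _
  have hflag : ∀ t ∈ KleinQuadric.Chamber.toFlag '' X, (KleinQuadric.kleinSpace K).IsFlag t := by
    rintro t ⟨c, -, rfl⟩
    exact c.isFlag_toFlag
  have hopp : ∀ t ∈ KleinQuadric.Chamber.toFlag '' X, ∀ t' ∈ KleinQuadric.Chamber.toFlag '' X,
      ¬ (KleinQuadric.kleinSpace K).Opp t t' := by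
    rintro t ⟨c, hc, rfl⟩ t' ⟨d, hd, rfl⟩ h
    exact hX c hc d hd (KleinQuadric.Chamber.opposite_of_opp h)
  have hcard : X.encard = ((KleinQuadric.Chamber.toFlag '' X).ncard : ℕ∞) := by
    rw [← KleinQuadric.Chamber.toFlag_injective.encard_image, Set.Finite.cast_ncard_eq (Set.toFinite _)]
  rw [hcard]
  refine ⟨?_, ?_, ?_⟩
  · exact_mod_cast ProjectiveSpace3.ncard_le hflag hopp (by omega)
  · intro h
    have h' : (KleinQuadric.Chamber.toFlag '' X).ncard =
        (Nat.card K ^ 2 + Nat.card K + 1) * (Nat.card K + 1) ^ 2 := by exact_mod_cast h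
    have hE : ∀ E : Submodule K (Fin 6 → K), KleinQuadric.Chamber.toFlag '' X =
        {t | (KleinQuadric.kleinSpace K).IsFlag t ∧ t.1.1 ≤ E} → X = {c : KleinQuadric.Chamber K | c.point ≤ E} := by
      intro E hE
      rw [← KleinQuadric.Chamber.image_toFlag] at hE
      exact KleinQuadric.Chamber.toFlag_injective.image_injective hE
    rcases ProjectiveSpace3.eq_of_ncard_eq hflag hopp (by omega) h' with ⟨U, hU⟩ | ⟨V, hV⟩
    · exact ⟨U.1, U.2.1, hE _ hU⟩
    · exact ⟨V.1, V.2.1, hE _ hV⟩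
  · rintro ⟨E, hE, rfl⟩
    rw [KleinQuadric.Chamber.image_toFlag]
    have h1 := (KleinQuadric.kleinSpace K).card_flags (fun P => P.1 ≤ E)
    rw [KleinQuadric.card_points_three hE.2 hE.1, mul_comm] at h1
    exact_mod_cast h1
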